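/- For $q\in\mathbb{C}$ consider the Rogers--Ramanujan continued fraction \[ K(q)=1+\cfrac{q}{1+\cfrac{q^{2}}{1+\cfrac{q^{3}}{1+\cdots}}} \] and the three Ramanujan--Selberg continued fractions \[ S_{1}(q)=1+\cfrac{q}{1+\cfrac{q+q^{2}}{1+\cfrac{q^{3}}{1+\cfrac{q^{2}+q^{4}}{1+\cdots}}}}, \] \[ S_{2}(q)=1+\cfrac{q+q^{2}}{1+\cfrac{q^{4}}{1+\cfrac{q^{3}+q^{6}}{1+\cfrac{q^{8}}{1+\cdots}}}}, \] \[ S_{3}(q)=1+\cfrac{q+q^{2}}{1+\cfrac{q^{2}+q^{4}}{1+\cfrac{q^{3}+q^{6}}{1+\cfrac{q^{4}+q^{8}}{1+\cdots}}}}. \] All partial denominators are $1$; for $n\ge 1$ the $n$-th partial numerator is $q^{n}$ for $K$; $q^{n}$ ($n$ odd) or $q^{n/2}+q^{n}$ ($n$ even) for $S_1$; $q^{n}+q^{2n}$ ($n$ odd) or $q^{2n}$ ($n$ even) for $S_2$; and $q^{n}+q^{2n}$ for $S_3$. Let $\hat{\mathbb{C}}=\mathbb{C}\cup\{\infty\}$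 carry the chordal metric $d(w,z)=\dfrac{|z-w|}{\sqrt{1+|w|^{2}}\sqrt{1+|z|^{2}}}$ for $w,z\in\mathbb{C}$, $d(w,\infty)=d(\infty,w)=\dfrac{1}{\sqrt{1+|w|^{2}}}$ for $w\in\mathbb{C}$, $d(\infty,\infty)=0$. For a continued fraction $M$ with $n$-th approximant $A_n/B_n$ (with $A_{-1}=1$, $B_{-1}=0$) put \[ T_{n}(w)=\frac{A_{n}+wA_{n-1}}{B_{n}+wB_{n-1}}\qquad (w\in\hat{\mathbb{C}}), \] so that $T_n(\infty)=A_{n-1}/B_{n-1}$. The continued fraction $M$ \emph{converges generally} if there are $f\in\hat{\mathbb{C}}$ and sequences $\{v_n\},\{w_n\}\subset\hat{\mathbb{C}}$ such that $\liminf_{n\to\infty} d(v_n,w_n)>0$ and $\lim_{n\to\infty}T_n(v_n)=\lim_{n\to\infty}T_n(w_n)=f$. Then, for each of the continued fractions $K(q)$, $S_{1}(q)$, $S_{2}(q)$ and $S_{3}(q)$, there exists an uncountable set of points $q$ on the unit circle $|q|=1$ at which the continued fraction does not converge generally. -/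

import Mathlib

open Filter Topology

noncomputable section

namespace QContFrac

/-- The continued fraction `1 + a 1 / (1 + a 2 / (1 + a 3 / (1 + ⋯)))`, all of whose partial
denominators are `1` (the value `a 0` is not used). -/
def ofNumerators (a : ℕ → ℂ) : GenContFract ℂ where
  h := 1
  s := Stream'.Seq.ofStream fun n => ⟨a (n + 1), 1⟩

/-- The quotient `A / B` as a point of the Riemann sphere `ℂ ∪ {∞}`, where `A / 0 = ∞`. -/
def quotient (A B : ℂ) : OnePoint ℂ :=
  open Classical in if B = 0 then OnePoint.infty else ((A / B : ℂ) : OnePoint ℂ)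

/-- The map `S_n(w) = (A_n + w * A_{n-1}) / (B_n + w * B_{n-1})` of the Riemann sphere, where
`A_n / B_n` is the `n`-th approximant of `M`, and `S_n(∞) = A_{n-1} / B_{n-1}`. Mathlib's sequence
`contsAux` is shifted by one: `M.contsAux (n + 1)` is the pair `(A_n, B_n)`, and `M.contsAux 0` is
`(A_{-1}, B_{-1}) = (1, 0)`. -/
def modifiedApproximant (M : GenContFract ℂ) (n : ℕ) : OnePoint ℂ → OnePoint ℂ
  | none => quotient (M.contsAux n).a (M.contsAux n).b
  | some w =>
      quotient ((M.contsAux (n + 1)).a + w * (M.contsAux n).a)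
        ((M.contsAux (n + 1)).b + w * (M.contsAux n).b)

/-- The chordal metric on the Riemann sphere. -/
def chordalDist : OnePoint ℂ → OnePoint ℂ → ℝ
  | some w, some z => ‖z - w‖ / (√(1 + ‖w‖ ^ 2) * √(1 + ‖z‖ ^ 2))
  | some w, none => 1 / √(1 + ‖w‖ ^ 2)
  | none, some z => 1 / √(1 + ‖z‖ ^ 2)
  | none, none => 0

/-- `M` converges generally to the point `f` of the Riemann sphere. -/
def ConvergesGenerallyTo (M : GenContFract ℂ) (f : OnePoint ℂ) : Prop :=
  ∃ v w : ℕ → OnePoint ℂ,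
    0 < liminf (fun n => chordalDist (v n) (w n)) atTop ∧
    Tendsto (fun n => modifiedApproximant M n (v n)) atTop (𝓝 f) ∧
    Tendsto (fun n => modifiedApproximant M n (w n)) atTop (𝓝 f)

/-- `M` converges in the general sense. -/
def ConvergesGenerally (M : GenContFract ℂ) : Prop :=
  ∃ f : OnePoint ℂ, ConvergesGenerallyTo M f

/-- The Rogers–Ramanujan continued fraction `1 + q/1 + q²/1 + q³/1 + ⋯`. -/
def rogersRamanujan (q : ℂ) : GenContFract ℂ :=
  ofNumerators fun n => q ^ n

/-- The first Ramanujan–Selberg continued fraction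
`1 + q/1 + (q + q²)/1 + q³/1 + (q² + q⁴)/1 + ⋯`. -/
def ramanujanSelberg₁ (q : ℂ) : GenContFract ℂ :=
  ofNumerators fun n => if Odd n then q ^ n else q ^ (n / 2) + q ^ n

/-- The second Ramanujan–Selberg continued fraction
`1 + (q + q²)/1 + q⁴/1 + (q³ + q⁶)/1 + q⁸/1 + ⋯`. -/
def ramanujanSelberg₂ (q : ℂ) : GenContFract ℂ :=
  ofNumerators fun n => if Odd n then q ^ n + q ^ (2 * n) else q ^ (2 * n)

/-- The third Ramanujan–Selberg continued fraction
`1 + (q + q²)/1 + (q² + q⁴)/1 + (q³ + q⁶)/1 + (q⁴ + q⁸)/1 + ⋯`. -/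
def ramanujanSelberg₃ (q : ℂ) : GenContFract ℂ :=
  ofNumerators fun n => q ^ n + q ^ (2 * n)

/-- The points of the unit circle at which the continued fraction `G` does not converge
generally. -/
def generalDivergenceSet (G : ℂ → GenContFract ℂ) : Set ℂ :=
  {q | ‖q‖ = 1 ∧ ¬ ConvergesGenerally (G q)}

end QContFrac

end

noncomputable section

namespace QContFrac

/-! At a root of unity `q` the numerators are periodic, so along multiples of a period `L` the
approximant matrices are powers of one period matrix `N`, times a fixed matrix. If `N` has a
dominant eigenvalue, these powers become projectively rank one, with image the dominant eigenvector.
For each continued fraction there are two families of roots of unity, each dense in the circle, for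
which the squared heights of these eigenvectors on the Riemann sphere lie in two disjoint closed
sets. Being approached infinitely often by rank-one maps with such images is a Gδ condition on `q`,
so by Baire (`residual_attracts`) a residual set of `q` satisfies both conditions. There a general
limit would have its squared height in both sets (`Attracts.heightSq_mem`), which is absurd.

The heights come from arithmetic. The symmetry `conj (a k) = a (L - k)` gives `N = !![A, c * conj b;
b, c * R]` with `A`, `R` real and `c = a L`. Knowing the trace and the determinant, one bounds a
suitable product of `A`, `R`, `b` by `1`, simultaneously at all primitive roots of the given order.
This product is an algebraic integer, so it is zero or of modulus exactly `1`
(`norm_aeval_eq_one_of_norm_le_one`); with the trace and determinant relations this fixes `|b|`, and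
`A` closely enough to locate the eigenvector. At orders `p ^ k` one detects nonvanishing by reducing
modulo `p`, where `q` becomes `1`.

The trace is found by replacing the powers of the root of unity by their multiples by an
indeterminate `X`. Cyclic invariance of the trace leaves only exponents divisible by the order, and
a degree bound leaves very few coefficients (`trace_transferMat_eq_one`, `trace_det_prodUpTo_pair`).
-/

/-- The ordered product `f 1 * f 2 * ⋯ * f n`. -/
def prodUpTo {M : Type*} [Monoid M] (f : ℕ → M) : ℕ → M
  | 0 => 1
  | n + 1 => prodUpTo f n * f (n + 1)

/-! ### Transfer matrices of a continued fraction. -/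

/-- The matrix of the Möbius transformation `w ↦ 1 + a / w`. -/
def numMat {R : Type*} [CommRing R] (a : R) : Matrix (Fin 2) (Fin 2) R :=
  !![1, a; 1, 0]

/-- The matrix of the composition of the first `n` transformations `w ↦ 1 + a k / w`. -/
def transferMat {R : Type*} [CommRing R] (a : ℕ → R) (n : ℕ) : Matrix (Fin 2) (Fin 2) R :=
  prodUpTo (fun k => numMat (a k)) n

/-- The matrix `!![A_n, A_{n-1}; B_n, B_{n-1}]` of the `n`-th modified approximant. -/
def contMat {R : Type*} [CommRing R] (a : ℕ → R) (n : ℕ) : Matrix (Fin 2) (Fin 2) R :=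
  transferMat a n * numMat 1

theorem contMat_succ {R : Type*} [CommRing R] (a : ℕ → R) (n : ℕ) :
    contMat a (n + 1) = contMat a n * !![1, 1; a (n + 1), 0] := by
  have h : numMat (a (n + 1)) * numMat 1 = numMat 1 * !![1, 1; a (n + 1), 0] := by
    ext i j
    fin_cases i <;> fin_cases j <;> simp [numMat, Matrix.mul_apply, Fin.sum_univ_two]
  rw [contMat, transferMat, prodUpTo, Matrix.mul_assoc, h, ← Matrix.mul_assoc]
  rfl

theorem contsAux_ofNumerators (a : ℕ → ℂ) (n : ℕ) :
    (ofNumerators a).contsAux (n + 1) = ⟨contMat a n 0 0, contMat a n 1 0⟩ ∧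
      (ofNumerators a).contsAux n = ⟨contMat a n 0 1, contMat a n 1 1⟩ := by
  induction n with
  | zero =>
    simp [GenContFract.contsAux, contMat, transferMat, prodUpTo, numMat, ofNumerators]
  | succ n ih =>
    have hs : (ofNumerators a).s.get? n = some ⟨a (n + 1), 1⟩ := rfl
    refine ⟨?_, ?_⟩
    · rw [GenContFract.contsAux_recurrence hs ih.2 ih.1, contMat_succ]
      simp [Matrix.mul_apply, Fin.sum_univ_two, mul_comm]
    · rw [ih.1, contMat_succ]
      simp [Matrix.mul_apply, Fin.sum_univ_two]

/-! ### Heights and homogeneous coordinates on the Riemann sphere. -/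

/-- The square of the height of a point of the sphere above the equatorial plane, as a function of
its stereographic projection. -/
def heightSq : OnePoint ℂ → ℝ
  | none => 1
  | some z => ((‖z‖ ^ 2 - 1) / (‖z‖ ^ 2 + 1)) ^ 2

theorem continuous_heightSq : Continuous heightSq := by
  rw [OnePoint.continuous_iff]
  constructor
  · have h1 : Tendsto (fun t : ℝ => (1 - 2 * (t + 1)⁻¹) ^ 2) atTop (𝓝 1) := by
      have : Tendsto (fun t : ℝ => (t + 1)⁻¹) atTop (𝓝 0) :=
        tendsto_inv_atTop_zero.comp (tendsto_atTop_add_const_right _ _ tendsto_id)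
      simpa using ((this.const_mul 2).const_sub 1).pow 2
    have h2 : Tendsto (fun z : ℂ => ‖z‖ ^ 2) (coclosedCompact ℂ) atTop := by
      rw [coclosedCompact_eq_cocompact]
      exact (tendsto_pow_atTop two_ne_zero).comp tendsto_norm_cocompact_atTop
    refine (h1.comp h2).congr fun z => ?_
    have : ‖z‖ ^ 2 + 1 ≠ 0 := by positivity
    change (1 - 2 * (‖z‖ ^ 2 + 1)⁻¹) ^ 2 = ((‖z‖ ^ 2 - 1) / (‖z‖ ^ 2 + 1)) ^ 2
    congr 1
    field_simp
    ring
  · change Continuous fun z : ℂ => ((‖z‖ ^ 2 - 1) / (‖z‖ ^ 2 + 1)) ^ 2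
    refine ((by fun_prop : Continuous fun z : ℂ => ‖z‖ ^ 2 - 1).div (by fun_prop) fun z => ?_).pow 2
    positivity

theorem heightSq_quotient {A B : ℂ} (h : A ≠ 0 ∨ B ≠ 0) :
    heightSq (quotient A B) = ((‖A‖ ^ 2 - ‖B‖ ^ 2) / (‖A‖ ^ 2 + ‖B‖ ^ 2)) ^ 2 := by
  unfold quotient
  split_ifs with hB
  · have hA : ‖A‖ ≠ 0 := by simpa [hB] using h
    change (1 : ℝ) = _
    simp [hB, div_self (pow_ne_zero 2 hA)]
  · have hB' : ‖B‖ ≠ 0 := by simpa using hB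
    change ((‖A / B‖ ^ 2 - 1) / (‖A / B‖ ^ 2 + 1)) ^ 2 = _
    rw [norm_div]
    congr 1
    field_simp

/-- A unit vector of homogeneous coordinates for a point of the sphere. -/
def unitRep : OnePoint ℂ → Fin 2 → ℂ
  -- The vector of `w` is proportional to `(1, w)`, because the numerator is `A_n + w * A_{n-1}`;
  -- images, in contrast, are read as first coordinate over second.
  | none => ![0, 1]
  | some w => ![((√(1 + ‖w‖ ^ 2))⁻¹ : ℝ), ((√(1 + ‖w‖ ^ 2))⁻¹ : ℝ) * w]

theorem sq_norm_unitRep (u : OnePoint ℂ) : ‖unitRep u 0‖ ^ 2 + ‖unitRep u 1‖ ^ 2 = 1 := by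
  cases u with
  | infty => change ‖(0 : ℂ)‖ ^ 2 + ‖(1 : ℂ)‖ ^ 2 = 1; simp
  | coe w =>
    change ‖(((√(1 + ‖w‖ ^ 2))⁻¹ : ℝ) : ℂ)‖ ^ 2 + ‖(((√(1 + ‖w‖ ^ 2))⁻¹ : ℝ) : ℂ) * w‖ ^ 2 = 1
    have h : 0 < 1 + ‖w‖ ^ 2 := by positivity
    rw [norm_mul, Complex.norm_real, Real.norm_eq_abs, mul_pow, sq_abs, inv_pow,
      Real.sq_sqrt h.le]
    field_simp

theorem chordalDist_eq_norm_det (u v : OnePoint ℂ) :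
    chordalDist u v = ‖unitRep u 0 * unitRep v 1 - unitRep u 1 * unitRep v 0‖ := by
  have hs : ∀ w : ℂ, 0 < √(1 + ‖w‖ ^ 2) := fun w => Real.sqrt_pos.2 (by positivity)
  cases u with
  | infty =>
    cases v with
    | infty => change (0 : ℝ) = ‖(0 : ℂ) * 1 - 1 * 0‖; simp
    | coe z =>
      change 1 / √(1 + ‖z‖ ^ 2) = ‖(0 : ℂ) * _ - 1 * (((√(1 + ‖z‖ ^ 2))⁻¹ : ℝ) : ℂ)‖
      rw [zero_mul, zero_sub, one_mul, norm_neg, Complex.norm_real, Real.norm_eq_abs,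
        abs_of_pos (inv_pos.2 (hs z)), one_div]
  | coe w =>
    cases v with
    | infty =>
      change 1 / √(1 + ‖w‖ ^ 2) = ‖(((√(1 + ‖w‖ ^ 2))⁻¹ : ℝ) : ℂ) * 1 - _ * 0‖
      rw [mul_zero, sub_zero, mul_one, Complex.norm_real, Real.norm_eq_abs,
        abs_of_pos (inv_pos.2 (hs w)), one_div]
    | coe z =>
      change ‖z - w‖ / (√(1 + ‖w‖ ^ 2) * √(1 + ‖z‖ ^ 2)) =
        ‖(((√(1 + ‖w‖ ^ 2))⁻¹ : ℝ) : ℂ) * ((((√(1 + ‖z‖ ^ 2))⁻¹ : ℝ) : ℂ) * z) -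
          (((√(1 + ‖w‖ ^ 2))⁻¹ : ℝ) : ℂ) * w * (((√(1 + ‖z‖ ^ 2))⁻¹ : ℝ) : ℂ)‖
      have : (((√(1 + ‖w‖ ^ 2))⁻¹ : ℝ) : ℂ) * ((((√(1 + ‖z‖ ^ 2))⁻¹ : ℝ) : ℂ) * z) -
          (((√(1 + ‖w‖ ^ 2))⁻¹ : ℝ) : ℂ) * w * (((√(1 + ‖z‖ ^ 2))⁻¹ : ℝ) : ℂ) =
          (((√(1 + ‖w‖ ^ 2))⁻¹ * (√(1 + ‖z‖ ^ 2))⁻¹ : ℝ) : ℂ) * (z - w) := by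
        push_cast
        ring
      rw [this, norm_mul, Complex.norm_real, Real.norm_eq_abs,
        abs_of_pos (mul_pos (inv_pos.2 (hs w)) (inv_pos.2 (hs z))), div_eq_inv_mul, mul_inv]

theorem quotient_mul_left {c : ℂ} (hc : c ≠ 0) (A B : ℂ) :
    quotient (c * A) (c * B) = quotient A B := by
  unfold quotient
  simp only [mul_eq_zero, hc, false_or, mul_div_mul_left _ _ hc]

theorem modifiedApproximant_ofNumerators (a : ℕ → ℂ) (n : ℕ) (u : OnePoint ℂ) :
    modifiedApproximant (ofNumerators a) n u =
      quotient ((contMat a n).mulVec (unitRep u) 0) ((contMat a n).mulVec (unitRep u) 1) := by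
  have h := contsAux_ofNumerators a n
  cases u with
  | infty =>
    change quotient ((ofNumerators a).contsAux n).a ((ofNumerators a).contsAux n).b =
      quotient ((contMat a n).mulVec ![0, 1] 0) ((contMat a n).mulVec ![0, 1] 1)
    rw [h.2]
    simp [Matrix.mulVec, dotProduct, Fin.sum_univ_two]
  | coe w =>
    have hs : ((√(1 + ‖w‖ ^ 2))⁻¹ : ℝ) ≠ 0 := inv_ne_zero (Real.sqrt_pos.2 (by positivity)).ne'
    have hs' : (((√(1 + ‖w‖ ^ 2))⁻¹ : ℝ) : ℂ) ≠ 0 := by exact_mod_cast hs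
    set c : ℂ := (((√(1 + ‖w‖ ^ 2))⁻¹ : ℝ) : ℂ) with hc
    change quotient (((ofNumerators a).contsAux (n + 1)).a + w * ((ofNumerators a).contsAux n).a)
        (((ofNumerators a).contsAux (n + 1)).b + w * ((ofNumerators a).contsAux n).b) =
      quotient ((contMat a n).mulVec ![c, c * w] 0) ((contMat a n).mulVec ![c, c * w] 1)
    rw [h.1, h.2, ← quotient_mul_left hs']
    congr 1 <;> simp [Matrix.mulVec, dotProduct, Fin.sum_univ_two] <;> ring

/-! ### Attraction by rank-one matrices obstructs general convergence. -/

/-- Infinitely many of the matrices `V n` are, up to a scalar, arbitrarily close to a matrix of rank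
one whose image is a point of the sphere with `heightSq` in `G`. -/
def Attracts (V : ℕ → Matrix (Fin 2) (Fin 2) ℂ) (G : Set ℝ) : Prop :=
  ∀ ε > 0, ∀ k, ∃ n ≥ k, ∃ (κ : ℂ) (s l : Fin 2 → ℂ), ‖s 0‖ ^ 2 + ‖s 1‖ ^ 2 = 1 ∧
    1 ≤ ‖l 0‖ + ‖l 1‖ ∧ (‖s 0‖ ^ 2 - ‖s 1‖ ^ 2) ^ 2 ∈ G ∧
    ∀ i j, ‖κ * V n i j - s i * l j‖ < ε

/-- Cramer's rule recovers `l` times the determinant of `u`, `v` from the two pairings, so they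
cannot both be small. -/
theorem norm_pairing_lower_bound {u v l : Fin 2 → ℂ} (hu : ‖u 0‖ ^ 2 + ‖u 1‖ ^ 2 = 1)
    (hv : ‖v 0‖ ^ 2 + ‖v 1‖ ^ 2 = 1) (hl : 1 ≤ ‖l 0‖ + ‖l 1‖) {δ : ℝ}
    (h : δ ≤ ‖u 0 * v 1 - u 1 * v 0‖) :
    δ / 4 ≤ ‖l 0 * u 0 + l 1 * u 1‖ ∨ δ / 4 ≤ ‖l 0 * v 0 + l 1 * v 1‖ := by
  by_contra! hcon
  obtain ⟨h1, h2⟩ := hcon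
  have bound : ∀ {x y : ℝ}, x ^ 2 + y ^ 2 = 1 → x ≤ 1 ∧ y ≤ 1 := fun {x y} hxy =>
    ⟨by nlinarith [sq_nonneg y], by nlinarith [sq_nonneg x]⟩
  have hu' := bound hu
  have hv' := bound hv
  set D := u 0 * v 1 - u 1 * v 0
  set α := l 0 * u 0 + l 1 * u 1
  set β := l 0 * v 0 + l 1 * v 1
  have e0 : l 0 * D = α * v 1 - β * u 1 := by simp only [D, α, β]; ring
  have e1 : l 1 * D = β * u 0 - α * v 0 := by simp only [D, α, β]; ring
  have b0 : ‖l 0‖ * ‖D‖ ≤ ‖α‖ + ‖β‖ := by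
    rw [← norm_mul, e0]
    refine (norm_sub_le _ _).trans ?_
    rw [norm_mul, norm_mul]
    nlinarith [norm_nonneg α, norm_nonneg β, norm_nonneg (v 1), norm_nonneg (u 1)]
  have b1 : ‖l 1‖ * ‖D‖ ≤ ‖α‖ + ‖β‖ := by
    rw [← norm_mul, e1]
    refine (norm_sub_le _ _).trans ?_
    rw [norm_mul, norm_mul]
    nlinarith [norm_nonneg α, norm_nonneg β, norm_nonneg (v 0), norm_nonneg (u 0)]
  have : ‖D‖ ≤ (‖l 0‖ + ‖l 1‖) * ‖D‖ := le_mul_of_one_le_left (norm_nonneg _) hl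
  nlinarith

/-- A vector close to a unit vector has nearly the same height. -/
theorem abs_height_sub_le {u s : Fin 2 → ℂ} {ε : ℝ} (hε : ε ≤ 1 / 12)
    (hs : ‖s 0‖ ^ 2 + ‖s 1‖ ^ 2 = 1) (h : ∀ i, ‖u i - s i‖ ≤ ε) :
    (u 0 ≠ 0 ∨ u 1 ≠ 0) ∧
    |(‖u 0‖ ^ 2 - ‖u 1‖ ^ 2) / (‖u 0‖ ^ 2 + ‖u 1‖ ^ 2) - (‖s 0‖ ^ 2 - ‖s 1‖ ^ 2)| ≤ 24 * ε := by
  have hε0 : 0 ≤ ε := (norm_nonneg _).trans (h 0)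
  have key : ∀ i, ‖s i‖ ≤ 1 → |‖u i‖ ^ 2 - ‖s i‖ ^ 2| ≤ 3 * ε := by
    intro i hi
    have h1 : |‖u i‖ - ‖s i‖| ≤ ε := (abs_norm_sub_norm_le _ _).trans (h i)
    have h2 : |‖u i‖ + ‖s i‖| ≤ 3 := by
      rw [abs_le] at *
      constructor <;> linarith [norm_nonneg (u i), norm_nonneg (s i)]
    have : ‖u i‖ ^ 2 - ‖s i‖ ^ 2 = (‖u i‖ - ‖s i‖) * (‖u i‖ + ‖s i‖) := by ring
    rw [this, abs_mul]
    nlinarith [abs_nonneg (‖u i‖ - ‖s i‖), abs_nonneg (‖u i‖ + ‖s i‖)]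
  have k0 := abs_le.1 (key 0 (by nlinarith [sq_nonneg ‖s 1‖]))
  have k1 := abs_le.1 (key 1 (by nlinarith [sq_nonneg ‖s 0‖]))
  have hpos : 1 / 2 ≤ ‖u 0‖ ^ 2 + ‖u 1‖ ^ 2 := by linarith
  refine ⟨?_, ?_⟩
  · by_contra! hcon
    rw [hcon.1, hcon.2] at hpos
    norm_num at hpos
  · set x := ‖u 0‖ ^ 2
    set y := ‖u 1‖ ^ 2
    set p := ‖s 0‖ ^ 2
    set r := ‖s 1‖ ^ 2
    have hp : 0 ≤ p := by positivity
    have hr : 0 ≤ r := by positivity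
    have e : (x - y) / (x + y) - (p - r) = ((x - y) - (p - r) * (x + y)) / (x + y) := by
      have : x + y ≠ 0 := by linarith
      field_simp
    have e2 : (x - y) - (p - r) * (x + y) = 2 * (r * (x - p) - p * (y - r)) := by
      have : r = 1 - p := by linarith
      rw [this]; ring
    rw [e, abs_div, abs_of_pos (by linarith : 0 < x + y), div_le_iff₀ (by linarith), e2, abs_le]
    constructor <;> nlinarith

/-- Chordal separation makes at least one of `v n`, `w n` pair substantially with the row vector
`l`, and its image is then close to `s`. It does not matter which one, since both image sequences
tend to `f`. -/
theorem Attracts.heightSq_mem {a : ℕ → ℂ} {G : Set ℝ} (hG : IsClosed G)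
    (h : Attracts (contMat a) G) {f : OnePoint ℂ} (hf : ConvergesGenerallyTo (ofNumerators a) f) :
    heightSq f ∈ G := by
  obtain ⟨v, w, hvw, hv, hw⟩ := hf
  obtain ⟨δ, hδ, hδ'⟩ := exists_between hvw
  have hev : ∀ᶠ n in atTop, δ < chordalDist (v n) (w n) := by
    refine eventually_lt_of_lt_liminf hδ' ?_
    refine isBoundedUnder_of_eventually_ge (a := 0) (Eventually.of_forall fun n => ?_)
    rw [chordalDist_eq_norm_det]
    exact norm_nonneg _
  have hv' := (continuous_heightSq.tendsto f).comp hv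
  have hw' := (continuous_heightSq.tendsto f).comp hw
  rw [← hG.closure_eq, Metric.mem_closure_iff]
  intro η hη
  -- The height estimate needs `1 / 12`; the squared heights will differ by at most `48 * ε₁`, which
  -- must be below `η / 2`.
  set ε₁ : ℝ := min (1 / 12) (η / 100) with hε₁
  have hε₁pos : 0 < ε₁ := by positivity
  obtain ⟨k, hk⟩ := eventually_atTop.1
    (hev.and ((Metric.tendsto_nhds.1 hv' (η / 2) (by positivity)).and
      (Metric.tendsto_nhds.1 hw' (η / 2) (by positivity))))
  -- Two matrix entries contribute `ε₁ * (δ / 8)` each, and the sum is divided by a pairing of size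
  -- at least `δ / 4`.
  obtain ⟨n, hn, κ, s, l, hs, hl, hsG, hV⟩ := h (ε₁ * (δ / 8)) (by positivity) k
  obtain ⟨hd, hvn, hwn⟩ := hk n hn
  have main : ∀ x : OnePoint ℂ, δ / 4 ≤ ‖l 0 * unitRep x 0 + l 1 * unitRep x 1‖ →
      dist (heightSq (modifiedApproximant (ofNumerators a) n x)) (heightSq f) < η / 2 →
      dist (heightSq f) ((‖s 0‖ ^ 2 - ‖s 1‖ ^ 2) ^ 2) < η := by
    intro x hx hxf
    set α := l 0 * unitRep x 0 + l 1 * unitRep x 1 with hα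
    set y := (contMat a n).mulVec (unitRep x) with hy
    have hα0 : 0 < ‖α‖ := lt_of_lt_of_le (by positivity) hx
    have hαne : α ≠ 0 := norm_pos_iff.1 hα0
    have hx1 := sq_norm_unitRep x
    have hx0' : ‖unitRep x 0‖ ≤ 1 := by nlinarith [sq_nonneg ‖unitRep x 1‖]
    have hx1' : ‖unitRep x 1‖ ≤ 1 := by nlinarith [sq_nonneg ‖unitRep x 0‖]
    have hclose : ∀ i, ‖α⁻¹ * κ * y i - s i‖ ≤ ε₁ := by
      intro i
      have e : α⁻¹ * κ * y i - s i = α⁻¹ * ((κ * contMat a n i 0 - s i * l 0) * unitRep x 0 +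
          (κ * contMat a n i 1 - s i * l 1) * unitRep x 1) := by
        have h1 : α⁻¹ * α = 1 := inv_mul_cancel₀ hαne
        have h2 : y i = contMat a n i 0 * unitRep x 0 + contMat a n i 1 * unitRep x 1 := by
          fin_cases i <;> simp [hy]
        rw [h2]
        linear_combination s i * h1 - s i * α⁻¹ * hα
      rw [e, norm_mul, norm_inv, inv_mul_le_iff₀ hα0]
      refine (norm_add_le _ _).trans ?_
      rw [norm_mul, norm_mul]
      have b0 := (hV i 0).le
      have b1 := (hV i 1).le
      nlinarith [norm_nonneg (unitRep x 0), norm_nonneg (unitRep x 1),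
        norm_nonneg (κ * contMat a n i 0 - s i * l 0),
        norm_nonneg (κ * contMat a n i 1 - s i * l 1)]
    obtain ⟨hne, hle⟩ := abs_height_sub_le (u := fun i => α⁻¹ * κ * y i) (min_le_left _ _) hs hclose
    have hc : α⁻¹ * κ ≠ 0 := by
      intro h0
      simp [h0] at hne
    have hq : heightSq (modifiedApproximant (ofNumerators a) n x) =
        ((‖α⁻¹ * κ * y 0‖ ^ 2 - ‖α⁻¹ * κ * y 1‖ ^ 2) /
          (‖α⁻¹ * κ * y 0‖ ^ 2 + ‖α⁻¹ * κ * y 1‖ ^ 2)) ^ 2 := by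
      rw [modifiedApproximant_ofNumerators, ← quotient_mul_left hc, heightSq_quotient hne]
    rw [hq] at hxf
    set t := (‖α⁻¹ * κ * y 0‖ ^ 2 - ‖α⁻¹ * κ * y 1‖ ^ 2) /
          (‖α⁻¹ * κ * y 0‖ ^ 2 + ‖α⁻¹ * κ * y 1‖ ^ 2) with ht
    set σ := ‖s 0‖ ^ 2 - ‖s 1‖ ^ 2 with hσ
    have ht1 : |t| ≤ 1 := by
      rw [ht, abs_div, abs_of_nonneg (by positivity :
        0 ≤ ‖α⁻¹ * κ * y 0‖ ^ 2 + ‖α⁻¹ * κ * y 1‖ ^ 2)]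
      refine div_le_one_of_le₀ ?_ (by positivity)
      rw [abs_le]
      constructor <;> nlinarith [sq_nonneg ‖α⁻¹ * κ * y 0‖, sq_nonneg ‖α⁻¹ * κ * y 1‖]
    have hσ1 : |σ| ≤ 1 := by
      rw [abs_le]
      constructor <;> nlinarith [sq_nonneg ‖s 0‖, sq_nonneg ‖s 1‖]
    have hts : |t ^ 2 - σ ^ 2| ≤ 48 * ε₁ := by
      have : t ^ 2 - σ ^ 2 = (t - σ) * (t + σ) := by ring
      rw [this, abs_mul]
      have : |t + σ| ≤ 2 := (abs_add_le _ _).trans (by linarith)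
      nlinarith [abs_nonneg (t - σ), abs_nonneg (t + σ)]
    have h48 : ε₁ ≤ η / 100 := min_le_right _ _
    rw [dist_comm] at hxf
    calc dist (heightSq f) (σ ^ 2) ≤ dist (heightSq f) (t ^ 2) + dist (t ^ 2) (σ ^ 2) :=
          dist_triangle _ _ _
      _ < η / 2 + η / 2 := by
          refine add_lt_add hxf ?_
          rw [Real.dist_eq]
          linarith
      _ = η := by ring
  refine ⟨_, hsG, ?_⟩
  rw [chordalDist_eq_norm_det] at hd
  rcases norm_pairing_lower_bound (sq_norm_unitRep _) (sq_norm_unitRep _) hl hd.le with hx | hx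
  · exact main _ hx hvn
  · exact main _ hx hwn

theorem not_convergesGenerally_of_attracts {a : ℕ → ℂ} {G₁ G₂ : Set ℝ} (hG₁ : IsClosed G₁)
    (hG₂ : IsClosed G₂) (hG : Disjoint G₁ G₂) (h₁ : Attracts (contMat a) G₁)
    (h₂ : Attracts (contMat a) G₂) : ¬ ConvergesGenerally (ofNumerators a) := by
  rintro ⟨f, hf⟩
  exact Set.disjoint_left.1 hG (h₁.heightSq_mem hG₁ hf) (h₂.heightSq_mem hG₂ hf)

/-! ### Baire category on the circle. -/

/-- The parametrization of the unit circle by the real line. -/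
def circlePoint (θ : ℝ) : ℂ :=
  Complex.exp (2 * Real.pi * Complex.I * θ)

theorem continuous_circlePoint : Continuous circlePoint := by
  unfold circlePoint
  fun_prop

theorem norm_circlePoint (θ : ℝ) : ‖circlePoint θ‖ = 1 := by
  rw [circlePoint, Complex.norm_exp]
  simp

theorem continuous_contMat_apply {a : ℂ → ℕ → ℂ} (ha : ∀ n, Continuous fun q => a q n) (n : ℕ) :
    ∀ i j, Continuous fun q => contMat (a q) n i j := by
  induction n with
  | zero =>
    intro i j
    simp only [contMat, transferMat, prodUpTo]
    exact continuous_const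
  | succ n ih =>
    intro i j
    have h0 := ih i 0
    have h1 := ih i 1
    have h2 := ha (n + 1)
    fin_cases j
    · simp only [contMat_succ, Matrix.mul_apply, Fin.sum_univ_two]
      have : Continuous fun q => contMat (a q) n i 0 + contMat (a q) n i 1 * a q (n + 1) := by
        fun_prop
      simpa using this
    · simp only [contMat_succ, Matrix.mul_apply, Fin.sum_univ_two]
      simpa using h0

/-- For fixed `n`, `κ`, `s`, `l` the approximation is an open condition on `θ`. Attraction is the
intersection over `k` of the resulting unions with tolerance `1 / (k + 1)`, each open and dense. -/
theorem residual_attracts {a : ℂ → ℕ → ℂ} (ha : ∀ n, Continuous fun q => a q n) {G : Set ℝ}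
    (hd : Dense {θ : ℝ | Attracts (contMat (a (circlePoint θ))) G}) :
    ∀ᶠ θ in residual ℝ, Attracts (contMat (a (circlePoint θ))) G := by
  set U : ℕ → Set ℝ := fun k => {θ | ∃ n ≥ k, ∃ (κ : ℂ) (s l : Fin 2 → ℂ),
    ‖s 0‖ ^ 2 + ‖s 1‖ ^ 2 = 1 ∧ 1 ≤ ‖l 0‖ + ‖l 1‖ ∧ (‖s 0‖ ^ 2 - ‖s 1‖ ^ 2) ^ 2 ∈ G ∧
    ∀ i j, ‖κ * contMat (a (circlePoint θ)) n i j - s i * l j‖ < 1 / ((k : ℝ) + 1)} with hU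
  have hopen : ∀ k, IsOpen (U k) := by
    intro k
    have : U k = ⋃ (n ≥ k) (κ : ℂ) (s : Fin 2 → ℂ) (l : Fin 2 → ℂ)
        (_ : ‖s 0‖ ^ 2 + ‖s 1‖ ^ 2 = 1 ∧ 1 ≤ ‖l 0‖ + ‖l 1‖ ∧ (‖s 0‖ ^ 2 - ‖s 1‖ ^ 2) ^ 2 ∈ G),
        ⋂ (i : Fin 2) (j : Fin 2),
          {θ | ‖κ * contMat (a (circlePoint θ)) n i j - s i * l j‖ < 1 / ((k : ℝ) + 1)} := by
      ext θ
      simp only [hU, Set.mem_ofPred_eq, Set.mem_iUnion, Set.mem_iInter, exists_prop, and_assoc]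
    rw [this]
    refine isOpen_iUnion fun n => isOpen_iUnion fun _ => isOpen_iUnion fun κ =>
      isOpen_iUnion fun s => isOpen_iUnion fun l => isOpen_iUnion fun _ =>
      isOpen_iInter_of_finite fun i => isOpen_iInter_of_finite fun j => ?_
    refine isOpen_lt ?_ continuous_const
    have := (continuous_contMat_apply ha n i j).comp continuous_circlePoint
    exact ((continuous_const.mul this).sub continuous_const).norm
  have hmem : ∀ k, U k ∈ residual ℝ := fun k => by
    refine residual_of_dense_open (hopen k) (hd.mono fun θ hθ => ?_)
    exact hθ _ (by positivity) k
  filter_upwards [eventually_countable_forall.2 hmem] with θ hθ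
  intro ε hε k
  obtain ⟨N, hN⟩ := exists_nat_one_div_lt hε
  obtain ⟨n, hn, κ, s, l, h1, h2, h3, h4⟩ := hθ (max k N)
  refine ⟨n, (le_max_left _ _).trans hn, κ, s, l, h1, h2, h3, fun i j => (h4 i j).trans ?_⟩
  refine lt_of_le_of_lt ?_ hN
  have : (N : ℝ) ≤ ((max k N : ℕ) : ℝ) := by exact_mod_cast le_max_right _ _
  gcongr

theorem injOn_circlePoint : Set.InjOn circlePoint (Set.Ioo 0 1) := by
  intro x hx y hy h
  unfold circlePoint at h
  obtain ⟨n, hn⟩ := Complex.exp_eq_exp_iff_exists_int.1 h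
  have h2 : (2 * Real.pi * Complex.I : ℂ) ≠ 0 := Complex.two_pi_I_ne_zero
  have h3 : (x : ℂ) = y + n := by
    apply mul_left_cancel₀ h2
    linear_combination hn
  have h4 : x = y + n := by exact_mod_cast h3
  have : n = 0 := by
    have a1 : (n : ℝ) < 1 := by linarith [hx.2, hy.1]
    have a2 : (-1 : ℝ) < n := by linarith [hx.1, hy.2]
    have a1' : n < 1 := by exact_mod_cast a1
    have a2' : -1 < n := by exact_mod_cast a2
    omega
  simpa [this] using h4

/-- If the points of the circle attracted by two disjoint closed sets of heights are both dense, then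
the continued fraction diverges generally at uncountably many points. -/
theorem not_countable_generalDivergenceSet {a : ℂ → ℕ → ℂ} (ha : ∀ n, Continuous fun q => a q n)
    {G₁ G₂ : Set ℝ} (hG₁ : IsClosed G₁) (hG₂ : IsClosed G₂) (hG : Disjoint G₁ G₂)
    (h₁ : Dense {θ : ℝ | Attracts (contMat (a (circlePoint θ))) G₁})
    (h₂ : Dense {θ : ℝ | Attracts (contMat (a (circlePoint θ))) G₂}) :
    ¬ (generalDivergenceSet fun q => ofNumerators (a q)).Countable := by
  intro hc
  set C := circlePoint ⁻¹' (generalDivergenceSet fun q => ofNumerators (a q)) ∩ Set.Ioo 0 1 with hC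
  have hCc : C.Countable := by
    refine Set.MapsTo.countable_of_injOn (f := circlePoint) (fun θ hθ => hθ.1)
      (injOn_circlePoint.mono Set.inter_subset_right) hc
  -- A countable divergence set could be discarded without leaving the residual filter, and a point
  -- of `(0, 1)` attracted by both sets would remain.
  have hCr : Cᶜ ∈ residual ℝ := by
    rw [mem_residual]
    exact ⟨Cᶜ, subset_rfl, hCc.isGδ_compl, hCc.dense_compl ℝ⟩
  have hall := (residual_attracts ha h₁).and ((residual_attracts ha h₂).and hCr)
  obtain ⟨θ, ⟨h1, h2, h3⟩, h4⟩ :=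
    (dense_of_mem_residual hall).exists_mem_open isOpen_Ioo (⟨1 / 2, by norm_num⟩ :
      (Set.Ioo (0 : ℝ) 1).Nonempty)
  exact h3 ⟨⟨norm_circlePoint θ, not_convergesGenerally_of_attracts hG₁ hG₂ hG h1 h2⟩, h4⟩

/-! ### Algebraic integers in cyclotomic fields. -/

open Polynomial in
-- The product of the conjugates is a nonzero integer, hence of modulus at least `1`, while every
-- factor has modulus at most `1`.
theorem norm_aeval_eq_one_of_norm_le_one {m : ℕ} {q : ℂ} (hm : 0 < m) (hq : IsPrimitiveRoot q m)
    (P : ℤ[X]) (hP : ∀ ζ : ℂ, IsPrimitiveRoot ζ m → ‖aeval ζ P‖ ≤ 1) (h0 : aeval q P ≠ 0) :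
    ‖aeval q P‖ = 1 := by
  have : NeZero (m : ℂ) := ⟨by exact_mod_cast hm.ne'⟩
  have hne : ∀ ζ : ℂ, IsPrimitiveRoot ζ m → aeval ζ P ≠ 0 := by
    intro ζ hζ h
    apply h0
    obtain ⟨R, hR⟩ := minpoly.isIntegrallyClosed_dvd (hζ.isIntegral hm) h
    have h1 : minpoly ℤ ζ = minpoly ℤ q := by
      rw [← cyclotomic_eq_minpoly hζ hm, ← cyclotomic_eq_minpoly hq hm]
    rw [hR, h1, map_mul, minpoly.aeval, zero_mul]
  -- The product is the resultant of the cyclotomic polynomial and `P`, both with integer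
  -- coefficients.
  have hprod : ∃ N : ℤ, ∏ ζ ∈ primitiveRoots m ℂ, aeval ζ P = (N : ℂ) := by
    refine ⟨resultant (cyclotomic m ℤ) P, ?_⟩
    have hdeg : (P.map (Int.castRingHom ℂ)).natDegree ≤ P.natDegree := natDegree_map_le
    have h1 := resultant_eq_prod_eval (cyclotomic m ℂ) (P.map (Int.castRingHom ℂ)) P.natDegree hdeg
      (IsAlgClosed.splits _)
    rw [cyclotomic.roots_eq_primitiveRoots_val, (cyclotomic.monic m ℂ).leadingCoeff, one_pow,
      one_mul, natDegree_cyclotomic, ← natDegree_cyclotomic m ℤ, ← map_cyclotomic_int,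
      resultant_map_map] at h1
    rw [eq_intCast] at h1
    rw [h1]
    change _ = ∏ ζ ∈ primitiveRoots m ℂ, eval ζ (P.map (Int.castRingHom ℂ))
    refine Finset.prod_congr rfl fun ζ _ => ?_
    rw [eval_map, aeval_def]
    rfl
  obtain ⟨N, hN⟩ := hprod
  have hN0 : N ≠ 0 := by
    rintro rfl
    rw [Int.cast_zero, Finset.prod_eq_zero_iff] at hN
    obtain ⟨ζ, hζ, hζ0⟩ := hN
    exact hne ζ (isPrimitiveRoot_of_mem_primitiveRoots hζ) hζ0
  have hN1 : (1 : ℝ) ≤ ‖∏ ζ ∈ primitiveRoots m ℂ, aeval ζ P‖ := by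
    rw [hN, Complex.norm_intCast]
    exact_mod_cast Int.one_le_abs hN0
  rw [norm_prod] at hN1
  refine le_antisymm (hP q hq) (hN1.trans ?_)
  have hmem : q ∈ primitiveRoots m ℂ := (mem_primitiveRoots hm).2 hq
  rw [← Finset.mul_prod_erase _ _ hmem]
  refine mul_le_of_le_one_right (norm_nonneg _) (Finset.prod_le_one (fun _ _ => norm_nonneg _) ?_)
  intro ζ hζ
  exact hP ζ (isPrimitiveRoot_of_mem_primitiveRoots (Finset.mem_of_mem_erase hζ))

open Polynomial in
-- A polynomial vanishing at `q` is divisible by the cyclotomic polynomial of order `p ^ (k + 1)`,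
-- whose value at `1` is `p`.
theorem aeval_ne_zero_of_eval_one_ne_zero {p : ℕ} [Fact p.Prime] {k : ℕ} {q : ℂ}
    (hq : IsPrimitiveRoot q (p ^ (k + 1))) (P : ℤ[X]) (hP : aeval (1 : ZMod p) P ≠ 0) :
    aeval q P ≠ 0 := by
  intro h
  have hpos : 0 < p ^ (k + 1) := pow_pos (Fact.out : p.Prime).pos _
  obtain ⟨R, hR⟩ := minpoly.isIntegrallyClosed_dvd (hq.isIntegral hpos) h
  apply hP
  rw [hR, ← cyclotomic_eq_minpoly hq hpos, map_mul, aeval_def, eval₂_one_cyclotomic_prime_pow,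
    CharP.cast_eq_zero, zero_mul]

theorem prod_range_sub_primitiveRoot {r : ℕ} {p : ℂ} (hr : 0 < r) (hp : IsPrimitiveRoot p r)
    (x α : ℂ) : ∏ i ∈ Finset.range r, (x - p ^ i * α) = x ^ r - α ^ r := by
  have h := X_pow_sub_C_eq_prod hp hr (rfl : α ^ r = α ^ r)
  have := congrArg (Polynomial.eval x) h
  simpa [Polynomial.eval_prod] using this.symm

theorem prod_range_succ_sub_primitiveRoot {r : ℕ} {p : ℂ} (hr : 0 < r) (hp : IsPrimitiveRoot p r)
    (x α : ℂ) : ∏ i ∈ Finset.range r, (x - p ^ (i + 1) * α) = x ^ r - α ^ r := by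
  have h := prod_range_sub_primitiveRoot hr hp x (p * α)
  rw [mul_pow, hp.pow_eq_one, one_mul] at h
  rw [← h]
  exact Finset.prod_congr rfl fun i _ => by ring

/-! ### Density of roots of unity of prescribed orders. -/

theorem circlePoint_int_div (a : ℤ) (m : ℕ) : circlePoint (a / m) = circlePoint (1 / m) ^ a := by
  unfold circlePoint
  rw [← Complex.exp_int_mul]
  congr 1
  push_cast
  ring

theorem isPrimitiveRoot_circlePoint {a : ℤ} {m : ℕ} (hm : m ≠ 0) (h : IsCoprime a (m : ℤ)) :
    IsPrimitiveRoot (circlePoint (a / m)) m := by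
  rw [circlePoint_int_div]
  refine IsPrimitiveRoot.zpow_of_gcd_eq_one ?_ a (Int.isCoprime_iff_gcd_eq_one.1 h)
  have := Complex.isPrimitiveRoot_exp m hm
  unfold circlePoint
  rwa [show (2 * Real.pi * Complex.I * ((1 / (m : ℝ) : ℝ) : ℂ) : ℂ) = 2 * Real.pi * Complex.I / m by
    push_cast
    ring]

/-- The primitive roots of unity of the orders `c * b ^ n` are dense in the circle. -/
theorem dense_of_isPrimitiveRoot {S : Set ℝ} {b c : ℕ} (hb : 2 ≤ b) (hc : 0 < c) (n₀ : ℕ)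
    (h : ∀ n ≥ n₀, ∀ θ, IsPrimitiveRoot (circlePoint θ) (c * b ^ n) → θ ∈ S) : Dense S := by
  rw [Metric.dense_iff]
  intro x ε hε
  have hb1 : (1 : ℝ) < b := by exact_mod_cast hb
  obtain ⟨n, hn, hn0⟩ : ∃ n : ℕ, (c * b + 1 : ℝ) / ε < (b : ℝ) ^ n ∧ n ≥ n₀ :=
    (((tendsto_pow_atTop_atTop_of_one_lt hb1).eventually_gt_atTop _).and
      (eventually_ge_atTop n₀)).exists
  set m : ℕ := c * b ^ n with hm
  have hm0 : m ≠ 0 := by positivity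
  have hmpos : (0 : ℝ) < m := by positivity
  have hmb : (c * b + 1 : ℝ) < ε * m := by
    rw [div_lt_iff₀ hε] at hn
    have : (1 : ℝ) ≤ c := by exact_mod_cast hc
    have hbn : (0 : ℝ) < (b : ℝ) ^ n := by positivity
    rw [hm]
    push_cast
    nlinarith [mul_pos hbn hε]
  set w : ℝ := (c * b : ℝ) with hw
  have hwpos : 0 < w := by positivity
  set t : ℤ := ⌊x * m / w⌋ with ht
  -- Numerators congruent to `1` modulo `c * b` are automatically coprime to `m`, and the fractions
  -- they give are only `c * b / m` apart.
  set a : ℤ := (c * b : ℤ) * t + 1 with ha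
  have hcop : IsCoprime a (m : ℤ) := by
    have hc' : IsCoprime a (c : ℤ) := ⟨1, -(b * t), by rw [ha]; ring⟩
    have hb' : IsCoprime a (b : ℤ) := ⟨1, -(c * t), by rw [ha]; ring⟩
    rw [hm]
    push_cast
    exact hc'.mul_right hb'.pow_right
  refine ⟨(a : ℝ) / m, ?_, h n hn0 _ (by exact_mod_cast isPrimitiveRoot_circlePoint hm0 hcop)⟩
  rw [Metric.mem_ball, Real.dist_eq]
  have h1 : (t : ℝ) * w ≤ x * m := by
    rw [← le_div_iff₀ hwpos]
    exact Int.floor_le _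
  have h2 : x * m < ((t : ℝ) + 1) * w := by
    rw [← div_lt_iff₀ hwpos]
    exact Int.lt_floor_add_one _
  have h3 : (a : ℝ) / m - x = (w * t + 1 - x * m) / m := by
    rw [ha, hw]
    push_cast
    field_simp
  rw [h3, abs_div, abs_of_pos hmpos, div_lt_iff₀ hmpos, abs_lt]
  constructor <;> nlinarith

/-! ### Ordered products and the Hermitian symmetry of the period matrix. -/

theorem prodUpTo_succ' {M : Type*} [Monoid M] (f : ℕ → M) (n : ℕ) :
    prodUpTo f (n + 1) = f 1 * prodUpTo (fun k => f (k + 1)) n := by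
  induction n with
  | zero => simp [prodUpTo]
  | succ n ih => rw [prodUpTo, ih, prodUpTo, mul_assoc]

theorem prodUpTo_congr {M : Type*} [Monoid M] {f g : ℕ → M} {n : ℕ}
    (h : ∀ k, 1 ≤ k → k ≤ n → f k = g k) : prodUpTo f n = prodUpTo g n := by
  induction n with
  | zero => rfl
  | succ n ih =>
    rw [prodUpTo, prodUpTo, ih fun k h1 h2 => h k h1 (by omega), h (n + 1) (by omega) le_rfl]

theorem map_prodUpTo {M N F : Type*} [Monoid M] [Monoid N] [FunLike F M N] [MonoidHomClass F M N]
    (φ : F) (f : ℕ → M) (n : ℕ) : φ (prodUpTo f n) = prodUpTo (fun k => φ (f k)) n := by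
  induction n with
  | zero => simp [prodUpTo]
  | succ n ih => simp [prodUpTo, ih]

theorem prodUpTo_eq_prod {M : Type*} [CommMonoid M] (f : ℕ → M) (n : ℕ) :
    prodUpTo f n = ∏ i ∈ Finset.range n, f (i + 1) := by
  induction n with
  | zero => simp [prodUpTo]
  | succ n ih => rw [prodUpTo, ih, Finset.prod_range_succ]

theorem prodUpTo_const {M : Type*} [Monoid M] (x : M) (n : ℕ) :
    prodUpTo (fun _ => x) n = x ^ n := by
  induction n with
  | zero => simp [prodUpTo]
  | succ n ih => rw [prodUpTo, ih, pow_succ]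

theorem prodUpTo_add {M : Type*} [Monoid M] (f : ℕ → M) (m n : ℕ) :
    prodUpTo f (m + n) = prodUpTo f m * prodUpTo (fun k => f (m + k)) n := by
  induction n with
  | zero => simp [prodUpTo]
  | succ n ih => rw [← add_assoc, prodUpTo, ih, prodUpTo, mul_assoc, add_assoc]

theorem prodUpTo_mul_of_periodic {M : Type*} [Monoid M] {f : ℕ → M} {L : ℕ}
    (h : ∀ k, f (k + L) = f k) (j : ℕ) : prodUpTo f (L * j) = prodUpTo f L ^ j := by
  induction j with
  | zero => simp [prodUpTo]
  | succ j ih =>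
    have hf : ∀ j k, f (L * j + k) = f k := by
      intro j
      induction j with
      | zero => simp
      | succ j ih => intro k; rw [← ih k, ← h (L * j + k)]; congr 1; ring
    rw [mul_add, mul_one, prodUpTo_add, ih, pow_succ]
    congr 2
    funext k
    exact hf j k

theorem prodUpTo_two_mul {M : Type*} [Monoid M] (f : ℕ → M) (n : ℕ) :
    prodUpTo f (2 * n) = prodUpTo (fun k => f (2 * k - 1) * f (2 * k)) n := by
  induction n with
  | zero => rfl
  | succ n ih =>
    rw [mul_add, mul_one, prodUpTo, prodUpTo, prodUpTo, ih, mul_assoc]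
    rfl

theorem trace_prodUpTo_shift {R : Type*} [CommRing R] {f : ℕ → Matrix (Fin 2) (Fin 2) R} {n : ℕ}
    (h : f (n + 1) = f 1) (hn : 0 < n) :
    (prodUpTo (fun k => f (k + 1)) n).trace = (prodUpTo f n).trace := by
  obtain ⟨n, rfl⟩ : ∃ l, n = l + 1 := ⟨n - 1, by omega⟩
  rw [prodUpTo_succ' f, prodUpTo, h, Matrix.trace_mul_comm]

theorem det_prodUpTo {R : Type*} [CommRing R] (f : ℕ → Matrix (Fin 2) (Fin 2) R) (n : ℕ) :
    (prodUpTo f n).det = ∏ i ∈ Finset.range n, (f (i + 1)).det := by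
  rw [← prodUpTo_eq_prod (fun k => (f k).det)]
  exact map_prodUpTo Matrix.detMonoidHom f n

theorem map_transferMat {R S : Type*} [CommRing R] [CommRing S] (φ : R →+* S) (a : ℕ → R) (n : ℕ) :
    (transferMat a n).map φ = transferMat (fun k => φ (a k)) n := by
  have h := map_prodUpTo φ.mapMatrix (fun k => numMat (a k)) n
  rw [RingHom.mapMatrix_apply] at h
  rw [transferMat, h, transferMat]
  congr 1
  funext k
  ext i j
  fin_cases i <;> fin_cases j <;> simp [numMat]

theorem transferMat_const {R : Type*} [CommRing R] (x : R) (n : ℕ) :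
    transferMat (fun _ => x) n = numMat x ^ n :=
  prodUpTo_const _ _

theorem det_transferMat {R : Type*} [CommRing R] (a : ℕ → R) (n : ℕ) :
    (transferMat a n).det = ∏ i ∈ Finset.range n, -a (i + 1) := by
  rw [transferMat, det_prodUpTo]
  simp [numMat, Matrix.det_fin_two]

/-- Splitting off the first numerator on the left and the last on the right are transposes of each
other. With a conjugation-reversal symmetry of the numerators this yields Hermitian matrices. -/
theorem transpose_contMat {R : Type*} [CommRing R] (n : ℕ) (a : ℕ → R) :
    (contMat a n).transpose = contMat (fun k => a (n + 1 - k)) n := by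
  have hF : (numMat (1 : R)).transpose = numMat 1 := by
    ext i j
    fin_cases i <;> fin_cases j <;> simp [numMat]
  induction n generalizing a with
  | zero => simp [contMat, transferMat, prodUpTo, hF]
  | succ n ih =>
    have h1 : contMat a (n + 1) = numMat (a 1) * contMat (fun k => a (k + 1)) n := by
      rw [contMat, transferMat, prodUpTo_succ', Matrix.mul_assoc]
      rfl
    have h2 : (numMat (a 1)).transpose = !![1, 1; a 1, 0] := by
      ext i j
      fin_cases i <;> fin_cases j <;> simp [numMat]
    rw [h1, Matrix.transpose_mul, ih, contMat_succ, h2]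
    congr 1
    · unfold contMat transferMat
      congr 1
      refine prodUpTo_congr fun k hk1 hk2 => ?_
      beta_reduce
      rw [show n + 1 - k + 1 = n + 1 + 1 - k by omega]
    · simp

theorem conjTranspose_contMat {a : ℕ → ℂ} {n : ℕ}
    (h : ∀ k, 1 ≤ k → k ≤ n → star (a k) = a (n + 1 - k)) :
    (contMat a n).conjTranspose = contMat a n := by
  have h1 : (contMat a n).map star = contMat (fun k => a (n + 1 - k)) n := by
    have := map_transferMat (starRingEnd ℂ) a n
    have h2 : (contMat a n).map star = (transferMat a n).map (starRingEnd ℂ) * numMat 1 := by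
      change (contMat a n).map (starRingEnd ℂ) = _
      rw [contMat, Matrix.map_mul]
      congr 1
      ext i j
      fin_cases i <;> fin_cases j <;> simp [numMat]
    rw [h2, this, contMat, transferMat, transferMat]
    congr 1
    refine prodUpTo_congr fun k hk1 hk2 => ?_
    congr 1
    exact h k hk1 hk2
  rw [Matrix.conjTranspose, Matrix.transpose_map, h1, ← transpose_contMat,
    Matrix.transpose_transpose]

theorem transferMat_succ_eq {R : Type*} [CommRing R] (a : ℕ → R) (n : ℕ) :
    transferMat a (n + 1) = contMat a n * !![1, 0; 0, a (n + 1)] := by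
  rw [transferMat, prodUpTo, contMat, Matrix.mul_assoc]
  congr 1
  ext i j
  fin_cases i <;> fin_cases j <;> simp [numMat, Matrix.mul_apply, Fin.sum_univ_two]

/-- The period matrix of a sequence of numerators with the symmetry `conj (a k) = a (L - k)`. -/
theorem exists_transferMat_eq {a : ℕ → ℂ} {L : ℕ} (hL : 0 < L)
    (h : ∀ k, 1 ≤ k → k < L → star (a k) = a (L - k)) :
    ∃ A R : ℝ, contMat a (L - 1) 1 1 = R ∧ ∃ b : ℂ, transferMat a L = !![(A : ℂ), a L * star b; b, a L * R] := by
  obtain ⟨n, rfl⟩ : ∃ l, L = l + 1 := ⟨L - 1, by omega⟩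
  have hH := conjTranspose_contMat (a := a) (n := n) fun k h1 h2 => h k h1 (by omega)
  have h00 := congrFun (congrFun hH 0) 0
  have h11 := congrFun (congrFun hH 1) 1
  have h01 := congrFun (congrFun hH 0) 1
  rw [Matrix.conjTranspose_apply] at h00 h11 h01
  obtain ⟨A, hA⟩ := Complex.conj_eq_iff_real.1 h00
  obtain ⟨R, hR⟩ := Complex.conj_eq_iff_real.1 h11
  refine ⟨A, R, hR, contMat a n 1 0, ?_⟩
  rw [transferMat_succ_eq, ← hA, ← hR, h01]
  ext i j
  fin_cases i <;> fin_cases j <;> simp [Matrix.mul_apply, Fin.sum_univ_two, mul_comm]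

/-! ### Trace of the period matrix for numerators `P (q ^ n)`. -/

open Polynomial

theorem coeff_eq_zero_of_comp_C_mul_X_eq {r : ℕ} {p : ℂ} (hp : IsPrimitiveRoot p r) {f : ℂ[X]}
    (hf : f.comp (C p * X) = f) {n : ℕ} (hn : ¬ r ∣ n) : f.coeff n = 0 := by
  have h := congrArg (fun g : ℂ[X] => g.coeff n) hf
  simp only [comp_C_mul_X_coeff] at h
  have h1 : p ^ n ≠ 1 := fun h => hn (hp.dvd_of_pow_eq_one n h)
  have h2 : f.coeff n * (p ^ n - 1) = 0 := by linear_combination h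
  exact (mul_eq_zero.1 h2).resolve_right (sub_ne_zero.2 h1)

theorem map_trace_fin_two {R S : Type*} [CommRing R] [CommRing S] (φ : R →+* S)
    (M : Matrix (Fin 2) (Fin 2) R) : φ M.trace = (M.map φ).trace := by
  simp [Matrix.trace_fin_two]

/-- No monomial of an entry uses two adjacent numerators, so at most about half of them occur in it.
-/
theorem natDegree_transferMat_le {a : ℕ → ℂ[X]} {e : ℕ} (ha : ∀ n, (a n).natDegree ≤ e) (n : ℕ) :
    (transferMat a (n + 1) 0 0).natDegree ≤ e * ((n + 1) / 2) ∧
    (transferMat a (n + 1) 0 1).natDegree ≤ e * ((n + 2) / 2) ∧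
    (transferMat a (n + 1) 1 0).natDegree ≤ e * (n / 2) ∧
    (transferMat a (n + 1) 1 1).natDegree ≤ e * ((n + 1) / 2) := by
  induction n with
  | zero => simp [transferMat, prodUpTo, numMat, ha 1]
  | succ n ih =>
    obtain ⟨h00, h01, h10, h11⟩ := ih
    have hU : transferMat a (n + 1 + 1) = transferMat a (n + 1) * numMat (a (n + 2)) := rfl
    have e0 : ∀ i, transferMat a (n + 1 + 1) i 0 =
        transferMat a (n + 1) i 0 + transferMat a (n + 1) i 1 := by
      intro i; rw [hU]; simp [numMat, Matrix.mul_apply, Fin.sum_univ_two]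
    have e1 : ∀ i, transferMat a (n + 1 + 1) i 1 = transferMat a (n + 1) i 0 * a (n + 2) := by
      intro i; rw [hU]; simp [numMat, Matrix.mul_apply, Fin.sum_univ_two]
    have mono : ∀ {x y : ℕ}, x ≤ y → e * (x / 2) ≤ e * (y / 2) := fun h =>
      Nat.mul_le_mul_left _ (Nat.div_le_div_right h)
    have half : ∀ x : ℕ, e * (x / 2) + e = e * ((x + 2) / 2) := fun x => by
      rw [Nat.add_div_right _ (by norm_num), Nat.mul_succ]
    refine ⟨?_, ?_, ?_, ?_⟩
    · rw [e0]
      exact (natDegree_add_le _ _).trans (max_le (h00.trans (mono (by omega))) h01)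
    · rw [e1]
      exact natDegree_mul_le.trans ((add_le_add h00 (ha _)).trans (half _).le)
    · rw [e0]
      exact (natDegree_add_le _ _).trans (max_le (h10.trans (mono (by omega))) h11)
    · rw [e1]
      exact natDegree_mul_le.trans ((add_le_add h10 (ha _)).trans (half _).le)

/-- The trace of the period matrix at a root of unity, when the numerators are the values of a
polynomial of low degree. -/
theorem trace_transferMat_eq_one {m e : ℕ} {q : ℂ} (hm : 0 < m) (hq : IsPrimitiveRoot q m) {P : ℂ[X]}
    (hP0 : P.coeff 0 = 0) (hPe : P.natDegree ≤ e) (hme : e * (m / 2) < m) :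
    (transferMat (fun n => P.eval (q ^ n)) m).trace = 1 := by
  -- The substitution `X ↦ q * X` shifts the sequence by one, which preserves the trace over a full
  -- period. Hence `τ` is a polynomial in `X ^ m` of degree below `m`, that is, the constant `τ(0)`.
  set a : ℕ → ℂ[X] := fun n => P.comp (C (q ^ n) * X) with ha
  set τ := (transferMat a m).trace with hτ
  have hinv : τ.comp (C q * X) = τ := by
    change compRingHom (C q * X) τ = τ
    rw [hτ, map_trace_fin_two, map_transferMat]
    have : (fun k => compRingHom (C q * X) (a k)) = fun k => a (k + 1) := by
      funext k
      simp only [ha, coe_compRingHom_apply, comp_assoc]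
      congr 1
      simp only [mul_comp, C_comp, X_comp]
      rw [← mul_assoc, ← C_mul, pow_succ]
    rw [this]
    refine trace_prodUpTo_shift (f := fun k => numMat (a k)) ?_ hm
    simp only [ha, pow_succ, hq.pow_eq_one, one_mul, pow_zero]
  have hdeg : τ.natDegree < m := by
    obtain ⟨n, rfl⟩ : ∃ l, m = l + 1 := ⟨m - 1, by omega⟩
    have hd : ∀ k, (a k).natDegree ≤ e := fun k => by
      refine natDegree_comp_le.trans (le_trans ?_ hPe)
      exact (Nat.mul_le_mul_left _ ((natDegree_C_mul_le _ _).trans natDegree_X_le)).trans (mul_one _).le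
    obtain ⟨h00, -, -, h11⟩ := natDegree_transferMat_le hd n
    rw [hτ, Matrix.trace_fin_two]
    exact ((natDegree_add_le _ _).trans (max_le h00 h11)).trans_lt hme
  have h0 : τ.coeff 0 = 1 := by
    rw [coeff_zero_eq_eval_zero]
    change evalRingHom 0 τ = 1
    rw [hτ, map_trace_fin_two, map_transferMat]
    have : (fun k => evalRingHom 0 (a k)) = fun _ => (0 : ℂ) := by
      funext k
      simp [ha, eval_comp, ← coeff_zero_eq_eval_zero, hP0]
    rw [this, transferMat_const]
    have hn : ∀ n : ℕ, numMat (0 : ℂ) ^ (n + 1) = numMat 0 := by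
      intro n
      induction n with
      | zero => simp
      | succ n ih =>
        rw [pow_succ, ih]
        ext i j
        fin_cases i <;> fin_cases j <;> simp [numMat, Matrix.mul_apply, Fin.sum_univ_two]
    obtain ⟨n, rfl⟩ : ∃ l, m = l + 1 := ⟨m - 1, by omega⟩
    rw [hn]
    simp [numMat, Matrix.trace_fin_two]
  have hτ1 : τ = 1 := by
    ext n
    rcases Nat.eq_zero_or_pos n with rfl | hn
    · simpa using h0
    · rw [coeff_one, if_neg hn.ne']
      by_cases hmn : n < m
      · exact coeff_eq_zero_of_comp_C_mul_X_eq hq hinv (Nat.not_dvd_of_pos_of_lt hn hmn)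
      · exact coeff_eq_zero_of_natDegree_lt (by omega)
  have h1 : evalRingHom 1 τ = 1 := by rw [hτ1, map_one]
  rw [hτ, map_trace_fin_two, map_transferMat] at h1
  simpa [ha, eval_comp] using h1

/-! ### Trace of the period matrix for numerators grouped in pairs. -/

/-- The quadratic matrix polynomial, at the point `t * X`, whose products over the powers `t` of a
root of unity `p` are the period matrices of the continued fractions with numerators of period two
in form. -/
def pairPoly (p α β γ t : ℂ) : Matrix (Fin 2) (Fin 2) ℂ[X] :=
  !![C p + C (α * t) * X + C (t ^ 2) * X ^ 2, 1 + C (β * t) * X;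
    C (t ^ 2) * X ^ 2, 1 + C (γ * t) * X]

theorem map_comp_pairPoly (p α β γ t s : ℂ) :
    (pairPoly p α β γ t).map (compRingHom (C s * X)) = pairPoly p α β γ (t * s) := by
  ext i j : 2
  fin_cases i <;> fin_cases j <;>
    simp [pairPoly] <;> ring_nf

theorem map_eval_zero_pairPoly (p α β γ t : ℂ) :
    (pairPoly p α β γ t).map (evalRingHom 0) = !![p, 1; 0, 1] := by
  ext i j
  fin_cases i <;> fin_cases j <;> simp [pairPoly]

theorem pow_upperTriangular {p : ℂ} {r : ℕ} (hr : 1 < r) (hp : IsPrimitiveRoot p r) :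
    (!![p, 1; 0, 1] : Matrix (Fin 2) (Fin 2) ℂ) ^ r = 1 := by
  have h : ∀ n : ℕ, (!![p, 1; 0, 1] : Matrix (Fin 2) (Fin 2) ℂ) ^ n =
      !![p ^ n, ∑ i ∈ Finset.range n, p ^ i; 0, 1] := by
    intro n
    induction n with
    | zero => ext i j; fin_cases i <;> fin_cases j <;> simp
    | succ n ih =>
      rw [pow_succ, ih, Finset.sum_range_succ]
      ext i j
      fin_cases i <;> fin_cases j <;>
        simp [Matrix.mul_apply, Fin.sum_univ_two, pow_succ, add_comm]
  rw [h, hp.pow_eq_one, hp.geom_sum_eq_zero hr]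
  ext i j
  fin_cases i <;> fin_cases j <;> simp

theorem prodUpTo_pairPoly_comm {p α β γ : ℂ} {r : ℕ} (hp : IsPrimitiveRoot p r) :
    pairPoly p α β γ p *
        (prodUpTo (fun k => pairPoly p α β γ (p ^ k)) r).map (compRingHom (C p * X)) =
      prodUpTo (fun k => pairPoly p α β γ (p ^ k)) r * pairPoly p α β γ p := by
  have h1 : (prodUpTo (fun k => pairPoly p α β γ (p ^ k)) r).map (compRingHom (C p * X)) =
      prodUpTo (fun k => pairPoly p α β γ (p ^ (k + 1))) r := by
    have := map_prodUpTo (compRingHom (C p * X)).mapMatrix (fun k => pairPoly p α β γ (p ^ k)) r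
    rw [RingHom.mapMatrix_apply] at this
    rw [this]
    congr 1
    funext k
    rw [RingHom.mapMatrix_apply, map_comp_pairPoly, pow_succ]
  have h2 := prodUpTo_succ' (fun k => pairPoly p α β γ (p ^ k)) r
  rw [prodUpTo, pow_succ, hp.pow_eq_one, one_mul, pow_one] at h2
  rw [h1, ← h2]

theorem X_sq_dvd_prodUpTo_pairPoly (p α β γ : ℂ) (n : ℕ) :
    X ^ 2 ∣ prodUpTo (fun k => pairPoly p α β γ (p ^ k)) n 1 0 := by
  induction n with
  | zero => simp [prodUpTo]
  | succ n ih =>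
    rw [prodUpTo, Matrix.mul_apply, Fin.sum_univ_two]
    refine dvd_add (ih.mul_right _) (Dvd.dvd.mul_left ?_ _)
    simp [pairPoly]

theorem exists_smul_of_map_eval_zero {D : Matrix (Fin 2) (Fin 2) ℂ[X]}
    (h : D.map (evalRingHom 0) = 0) : ∃ E : Matrix (Fin 2) (Fin 2) ℂ[X], D = (X : ℂ[X]) • E := by
  have h' : ∀ i j, ∃ e, D i j = X * e := fun i j => by
    have := congrFun (congrFun h i) j
    rw [← dvd_def, X_dvd_iff, coeff_zero_eq_eval_zero]
    simpa using this
  choose E hE using h'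
  exact ⟨Matrix.of E, by ext i j : 2; simp [hE]⟩

/-- An intertwiner of the eigenvalues `p` and `1` of the constant term vanishes off resonance. -/
theorem eq_zero_of_smul_mul_eq {p c : ℂ} (hp0 : p ≠ 0) {e : Matrix (Fin 2) (Fin 2) ℂ}
    (h : c • (!![p, 1; 0, 1] * e) = e * !![p, 1; 0, 1]) (h1 : c ≠ 1) (h2 : c ≠ p ∨ e 1 0 = 0)
    (h3 : c * p ≠ 1) : e = 0 := by
  have e00 := congrFun (congrFun h 0) 0
  have e01 := congrFun (congrFun h 0) 1
  have e10 := congrFun (congrFun h 1) 0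
  have e11 := congrFun (congrFun h 1) 1
  simp only [Matrix.smul_apply, Matrix.mul_apply, Fin.sum_univ_two, smul_eq_mul, Matrix.of_apply,
    Matrix.cons_val_zero, Matrix.cons_val_one, Matrix.cons_val', Matrix.cons_val_fin_one, zero_mul,
    one_mul, mul_one, mul_zero, zero_add, add_zero] at e00 e01 e10 e11
  have z10 : e 1 0 = 0 := by
    rcases h2 with h2 | h2
    · have : (c - p) * e 1 0 = 0 := by linear_combination e10
      exact (mul_eq_zero.1 this).resolve_left (sub_ne_zero.2 h2)
    · exact h2
  have z00 : e 0 0 = 0 := by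
    have : (c - 1) * (p * e 0 0) = 0 := by rw [z10] at e00; linear_combination e00
    exact (mul_eq_zero.1 ((mul_eq_zero.1 this).resolve_left (sub_ne_zero.2 h1))).resolve_left hp0
  have z11 : e 1 1 = 0 := by
    have : (c - 1) * e 1 1 = 0 := by rw [z10] at e11; linear_combination e11
    exact (mul_eq_zero.1 this).resolve_left (sub_ne_zero.2 h1)
  have z01 : e 0 1 = 0 := by
    have : (c * p - 1) * e 0 1 = 0 := by rw [z00, z11] at e01; linear_combination e01
    exact (mul_eq_zero.1 this).resolve_left (sub_ne_zero.2 h3)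
  ext i j
  fin_cases i <;> fin_cases j <;> simp [z00, z01, z10, z11]

/-- Compare lowest-order terms in `Q * M(p X) = M * Q`: the first nonconstant coefficient of `M`
intertwines the constant term of `Q`, with eigenvalues `p` and `1`, with its multiple by a power of
`p`. Off resonance it must vanish. -/
theorem prodUpTo_pairPoly_sub_one {p α β γ : ℂ} {r : ℕ} (hr : 3 ≤ r) (hp : IsPrimitiveRoot p r) :
    ∃ E : Matrix (Fin 2) (Fin 2) ℂ[X],
      prodUpTo (fun k => pairPoly p α β γ (p ^ k)) r = 1 + (X ^ (r - 1) : ℂ[X]) • E := by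
  set M := prodUpTo (fun k => pairPoly p α β γ (p ^ k)) r with hM
  set Q := pairPoly p α β γ p with hQ
  have hp0 : p ≠ 0 := hp.ne_zero (by omega)
  have key : ∀ n : ℕ, n + 1 ≤ r - 1 →
      ∃ E : Matrix (Fin 2) (Fin 2) ℂ[X], M = 1 + (X ^ (n + 1) : ℂ[X]) • E := by
    intro n
    induction n with
    | zero =>
      intro _
      have h0 : (M - 1).map (evalRingHom 0) = 0 := by
        have := map_prodUpTo (evalRingHom (0 : ℂ)).mapMatrix (fun k => pairPoly p α β γ (p ^ k)) r
        rw [← RingHom.mapMatrix_apply, map_sub, map_one, this, sub_eq_zero]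
        simp only [RingHom.mapMatrix_apply, map_eval_zero_pairPoly]
        rw [prodUpTo_const, pow_upperTriangular (by omega) hp]
      obtain ⟨E, hE⟩ := exists_smul_of_map_eval_zero h0
      exact ⟨E, by rw [zero_add, pow_one, ← hE]; abel⟩
    | succ n ih =>
      intro hn
      obtain ⟨E, hE⟩ := ih (by omega)
      have hcomm := prodUpTo_pairPoly_comm (α := α) (β := β) (γ := γ) hp
      rw [← hM, ← hQ] at hcomm
      set E' := E.map (compRingHom (C p * X)) with hE'
      have hME : M.map (compRingHom (C p * X)) = 1 + (X ^ (n + 1) * C (p ^ (n + 1)) : ℂ[X]) • E' := by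
        rw [← RingHom.mapMatrix_apply, hE, map_add, map_one]
        congr 1
        ext i j : 2
        simp [hE', mul_pow]
        ring_nf
      rw [hME, hE, mul_add, add_mul, mul_one, one_mul, add_right_inj, Matrix.mul_smul,
        Matrix.smul_mul, mul_smul] at hcomm
      have hX : (X ^ (n + 1) : ℂ[X]) ≠ 0 := pow_ne_zero _ X_ne_zero
      have hcancel : C (p ^ (n + 1)) • (Q * E') = E * Q := smul_right_injective _ hX hcomm
      set e := E.map (evalRingHom (0 : ℂ)) with he
      have hee : E'.map (evalRingHom (0 : ℂ)) = e := by
        ext i j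
        simp [hE', he, eval_comp]
      have hev := congrArg (fun N : Matrix (Fin 2) (Fin 2) ℂ[X] => N.map (evalRingHom (0 : ℂ))) hcancel
      have hl : (C (p ^ (n + 1)) • (Q * E')).map (evalRingHom (0 : ℂ)) =
          p ^ (n + 1) • (!![p, 1; 0, 1] * e) := by
        rw [← map_eval_zero_pairPoly p α β γ p, ← hee, ← Matrix.map_mul, ← hQ]
        ext i j
        simp
      have hr' : (E * Q).map (evalRingHom (0 : ℂ)) = e * !![p, 1; 0, 1] := by
        rw [Matrix.map_mul, map_eval_zero_pairPoly]
      simp only [hl, hr'] at hev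
      have hpow : ∀ k, 0 < k → k < r → p ^ k ≠ 1 := fun k h1 h2 => hp.pow_ne_one_of_pos_of_lt h1.ne' h2
      have hez : e = 0 := by
        refine eq_zero_of_smul_mul_eq hp0 hev (hpow _ (by omega) (by omega)) ?_ ?_
        -- At order one the factor is `p` itself, a resonance in the lower left entry; that entry is
        -- divisible by `X ^ 2`, which removes it.
        · rcases Nat.eq_zero_or_pos n with rfl | hn0
          · right
            have hd : X ^ 2 ∣ M 1 0 := X_sq_dvd_prodUpTo_pairPoly p α β γ r
            have h10 : M 1 0 = X * E 1 0 := by rw [hE]; simp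
            rw [h10, pow_two] at hd
            have := (mul_dvd_mul_iff_left (X_ne_zero (R := ℂ))).1 hd
            rw [X_dvd_iff, coeff_zero_eq_eval_zero] at this
            simpa [he] using this
          · left
            intro h
            apply hpow n hn0 (by omega)
            rw [pow_succ] at h
            exact mul_right_cancel₀ hp0 (by rw [h, one_mul])
        · rw [← pow_succ]
          exact hpow _ (by omega) (by omega)
      obtain ⟨F, hF⟩ := exists_smul_of_map_eval_zero hez
      exact ⟨F, by rw [hE, hF, smul_smul, ← pow_succ]⟩
  obtain ⟨E, hE⟩ := key (r - 2) (by omega)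
  exact ⟨E, by rw [hE]; congr 3; omega⟩

theorem natDegree_pairPoly_le (p α β γ t : ℂ) (i j : Fin 2) :
    (pairPoly p α β γ t i j).natDegree ≤ 2 := by
  fin_cases i <;> fin_cases j <;> simp only [pairPoly] <;> simp <;> compute_degree!

theorem natDegree_prodUpTo_pairPoly_le (p α β γ : ℂ) (n : ℕ) (i j : Fin 2) :
    (prodUpTo (fun k => pairPoly p α β γ (p ^ k)) n i j).natDegree ≤ 2 * n := by
  induction n generalizing j with
  | zero =>
    simp only [prodUpTo, Matrix.one_apply]
    split_ifs <;> simp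
  | succ n ih =>
    rw [prodUpTo, Matrix.mul_apply, Fin.sum_univ_two]
    refine natDegree_add_le_of_degree_le ?_ ?_ <;>
      exact natDegree_mul_le.trans (add_le_add (ih _) (natDegree_pairPoly_le _ _ _ _ _ _ _))

/-- The coefficient of `X ^ 2` in each factor is `t ^ 2 * !![1, 0; 1, 0]`, so the products of top
coefficients keep a zero second column. -/
theorem coeff_prodUpTo_pairPoly (p α β γ : ℂ) (n : ℕ) :
    (prodUpTo (fun k => pairPoly p α β γ (p ^ k)) (n + 1) 0 0).coeff (2 * (n + 1)) =
        ∏ k ∈ Finset.range (n + 1), (p ^ 2) ^ (k + 1) ∧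
      (prodUpTo (fun k => pairPoly p α β γ (p ^ k)) (n + 1) 0 1).coeff (2 * (n + 1)) = 0 ∧
      (prodUpTo (fun k => pairPoly p α β γ (p ^ k)) (n + 1) 1 1).coeff (2 * (n + 1)) = 0 := by
  have top : ∀ t : ℂ, (pairPoly p α β γ t 0 0).coeff 2 = t ^ 2 ∧
      (pairPoly p α β γ t 0 1).coeff 2 = 0 ∧ (pairPoly p α β γ t 1 0).coeff 2 = t ^ 2 ∧
      (pairPoly p α β γ t 1 1).coeff 2 = 0 := by
    intro t
    simp [pairPoly, coeff_one, coeff_X_pow, -map_pow]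
  induction n with
  | zero =>
    have h : prodUpTo (fun k => pairPoly p α β γ (p ^ k)) (0 + 1) = pairPoly p α β γ p := by
      simp [prodUpTo]
    obtain ⟨h1, h2, -, h4⟩ := top p
    rw [h]
    exact ⟨by simpa using h1, by simpa using h2, by simpa using h4⟩
  | succ n ih =>
    obtain ⟨i1, i2, i3⟩ := ih
    obtain ⟨h1, h2, h3, h4⟩ := top (p ^ (n + 1 + 1))
    have hstep : ∀ i j, (prodUpTo (fun k => pairPoly p α β γ (p ^ k)) (n + 1 + 1) i j).coeff
        (2 * (n + 1 + 1)) =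
        (prodUpTo (fun k => pairPoly p α β γ (p ^ k)) (n + 1) i 0).coeff (2 * (n + 1)) *
          (pairPoly p α β γ (p ^ (n + 1 + 1)) 0 j).coeff 2 +
        (prodUpTo (fun k => pairPoly p α β γ (p ^ k)) (n + 1) i 1).coeff (2 * (n + 1)) *
          (pairPoly p α β γ (p ^ (n + 1 + 1)) 1 j).coeff 2 := by
      intro i j
      rw [prodUpTo, Matrix.mul_apply, Fin.sum_univ_two, coeff_add,
        show 2 * (n + 1 + 1) = 2 * (n + 1) + 2 by ring,
        coeff_mul_add_eq_of_natDegree_le (natDegree_prodUpTo_pairPoly_le _ _ _ _ _ _ _)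
          (natDegree_pairPoly_le _ _ _ _ _ _ _),
        coeff_mul_add_eq_of_natDegree_le (natDegree_prodUpTo_pairPoly_le _ _ _ _ _ _ _)
          (natDegree_pairPoly_le _ _ _ _ _ _ _)]
    refine ⟨?_, ?_, ?_⟩
    · rw [hstep, i1, i2, h1, Finset.prod_range_succ _ (n + 1)]
      ring
    · rw [hstep, h2, h4]
      ring
    · rw [hstep, h2, h4]
      ring

theorem prod_range_pow_succ {r : ℕ} {p : ℂ} (hp : IsPrimitiveRoot p r) :
    ∏ k ∈ Finset.range r, (p ^ 2) ^ (k + 1) = 1 := by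
  rw [Finset.prod_pow_eq_pow_sum, ← pow_mul, mul_comm, Finset.sum_add_distrib, add_mul,
    Finset.sum_range_id_mul_two, Finset.sum_const, Finset.card_range, smul_eq_mul, mul_one, pow_add,
    pow_mul, pow_mul, hp.pow_eq_one, one_pow, one_pow, one_mul]

theorem det_prodUpTo_pairPoly {p α β γ η : ℂ} {r : ℕ} (hr : 0 < r) (hp : IsPrimitiveRoot p r)
    (hη : ∀ z : ℂ, (p + α * z + z ^ 2) * (1 + γ * z) - (1 + β * z) * z ^ 2 = p * (1 + η * z)) :
    (prodUpTo (fun k => pairPoly p α β γ (p ^ k)) r).det = 1 - C ((-η) ^ r) * X ^ r := by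
  rw [det_prodUpTo]
  refine Polynomial.funext fun x => ?_
  rw [eval_prod]
  have h1 : ∀ i ∈ Finset.range r, eval x (pairPoly p α β γ (p ^ (i + 1))).det =
      p * (1 - p ^ (i + 1) * (-η * x)) := by
    intro i _
    have := hη (p ^ (i + 1) * x)
    simp only [pairPoly, Matrix.det_fin_two_of, eval_sub, eval_mul, eval_add, eval_C, eval_X,
      eval_pow, eval_one]
    linear_combination this
  rw [Finset.prod_congr rfl h1, Finset.prod_mul_distrib, Finset.prod_const, Finset.card_range,
    hp.pow_eq_one, one_mul, prod_range_succ_sub_primitiveRoot hr hp]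
  rw [mul_pow]
  simp

/-- The trace and the determinant of the product of a quadratic matrix polynomial over the powers
of a root of unity. -/
theorem trace_det_prodUpTo_pair {p α β γ η : ℂ} {r : ℕ} (hr : 3 ≤ r) (hp : IsPrimitiveRoot p r)
    (hη : ∀ z : ℂ, (p + α * z + z ^ 2) * (1 + γ * z) - (1 + β * z) * z ^ 2 = p * (1 + η * z)) :
    (prodUpTo (fun k => !![p + α * p ^ k + (p ^ k) ^ 2, 1 + β * p ^ k;
        (p ^ k) ^ 2, 1 + γ * p ^ k]) r).trace = 3 - (-η) ^ r ∧
    (prodUpTo (fun k => !![p + α * p ^ k + (p ^ k) ^ 2, 1 + β * p ^ k;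
        (p ^ k) ^ 2, 1 + γ * p ^ k]) r).det = 1 - (-η) ^ r := by
  set M := prodUpTo (fun k => pairPoly p α β γ (p ^ k)) r with hM
  have hdet : M.det = 1 - C ((-η) ^ r) * X ^ r := det_prodUpTo_pairPoly (by omega) hp hη
  obtain ⟨E, hE⟩ := prodUpTo_pairPoly_sub_one (α := α) (β := β) (γ := γ) hr hp
  rw [← hM] at hE
  have hinv : M.trace.comp (C p * X) = M.trace := by
    change compRingHom (C p * X) M.trace = M.trace
    rw [map_trace_fin_two, ← RingHom.mapMatrix_apply, hM, map_prodUpTo]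
    have : (fun k => (compRingHom (C p * X)).mapMatrix (pairPoly p α β γ (p ^ k))) =
        fun k => pairPoly p α β γ (p ^ (k + 1)) := by
      funext k
      rw [RingHom.mapMatrix_apply, map_comp_pairPoly, pow_succ]
    rw [this]
    refine trace_prodUpTo_shift (f := fun k => pairPoly p α β γ (p ^ k)) ?_ (by omega)
    simp only [pow_succ, hp.pow_eq_one, pow_zero]
  -- By cyclic invariance and the degree bound only the exponents `0`, `r` and `2 * r` can occur.
  have htr : M.trace = C 2 - C ((-η) ^ r) * X ^ r + X ^ (2 * r) := by
    have e1 : M.trace = 2 + X ^ (r - 1) * E.trace := by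
      rw [hE, Matrix.trace_add, Matrix.trace_smul, Matrix.trace_one]
      simp
    -- With `M = 1 + X ^ (r - 1) • E`, the trace and `det M + 1` differ by a multiple of `X ^ (2 * r
    -- - 2)`. As `r ≥ 3`, this exponent exceeds `r`, so the middle coefficient can be read off the
    -- determinant.
    have e2 : M.trace = M.det + 1 - X ^ (r + 1) * (X ^ (r - 3) * E.det) := by
      have hX : (X : ℂ[X]) ^ (r + 1) * X ^ (r - 3) = X ^ (r - 1) * X ^ (r - 1) := by
        rw [← pow_add, ← pow_add]
        congr 1
        omega
      rw [← mul_assoc, hX, e1, hE, Matrix.det_fin_two, Matrix.det_fin_two, Matrix.trace_fin_two]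
      simp
      ring
    have hR : ∀ n, (C 2 - C ((-η) ^ r) * X ^ r + X ^ (2 * r) : ℂ[X]).coeff n =
        (if n = 0 then 2 else 0) - (-η) ^ r * (if n = r then 1 else 0) +
          (if n = 2 * r then 1 else 0) := by
      intro n
      rw [coeff_add, coeff_sub, coeff_C_mul, coeff_X_pow, coeff_X_pow, coeff_C]
    ext n
    rw [hR]
    by_cases hn : r ∣ n
    · obtain ⟨c, rfl⟩ := hn
      rcases c with _ | _ | _ | c
      · rw [if_pos (by omega), if_neg (by omega), if_neg (by omega), e1, coeff_add,
          coeff_X_pow_mul', if_neg (by omega)]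
        simp
      · rw [if_neg (by omega), if_pos (by omega), if_neg (by omega), e2, hdet, coeff_sub,
          coeff_X_pow_mul', if_neg (by omega)]
        simp only [zero_add, mul_one, coeff_add, coeff_sub, coeff_C_mul, coeff_X_pow, coeff_one,
          if_neg (by omega : r ≠ 0), if_true]
        ring
      · rw [if_neg (by omega), if_neg (by omega), if_pos (by omega)]
        obtain ⟨n, rfl⟩ : ∃ l, r = l + 1 := ⟨r - 1, by omega⟩
        obtain ⟨h1, -, h2⟩ := coeff_prodUpTo_pairPoly p α β γ n
        rw [Matrix.trace_fin_two, coeff_add, mul_comm (n + 1), zero_add, one_add_one_eq_two, hM, h1,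
          h2, prod_range_pow_succ hp]
        ring
      · have hlt : 2 * r < r * (c + 1 + 1 + 1) := by nlinarith
        rw [if_neg (by omega), if_neg (by omega), if_neg (by omega)]
        rw [coeff_eq_zero_of_natDegree_lt]
        · ring
        · refine lt_of_le_of_lt ?_ hlt
          rw [Matrix.trace_fin_two]
          exact natDegree_add_le_of_degree_le (natDegree_prodUpTo_pairPoly_le _ _ _ _ _ _ _)
            (natDegree_prodUpTo_pairPoly_le _ _ _ _ _ _ _)
    · rw [coeff_eq_zero_of_comp_C_mul_X_eq hp hinv hn, if_neg, if_neg, if_neg]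
      · ring
      · rintro rfl
        exact hn (dvd_mul_left _ _)
      · rintro rfl
        exact hn dvd_rfl
      · rintro rfl
        exact hn (dvd_zero _)
  have hmap : M.map (evalRingHom 1) = prodUpTo (fun k =>
      !![p + α * p ^ k + (p ^ k) ^ 2, 1 + β * p ^ k; (p ^ k) ^ 2, 1 + γ * p ^ k]) r := by
    rw [← RingHom.mapMatrix_apply, hM, map_prodUpTo]
    congr 1
    funext k
    ext i j
    fin_cases i <;> fin_cases j <;> simp [pairPoly]
  rw [← hmap, ← map_trace_fin_two, ← RingHom.mapMatrix_apply, ← RingHom.map_det, htr, hdet]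
  constructor
  · simp
    ring
  · simp

/-! ### Periodic continued fractions and the dominant eigenvector. -/

theorem exists_eq_mul_of_det_eq_zero {W : Matrix (Fin 2) (Fin 2) ℂ} (h0 : W ≠ 0) (hW : W.det = 0) :
    ∃ s l : Fin 2 → ℂ, ‖s 0‖ ^ 2 + ‖s 1‖ ^ 2 = 1 ∧ 0 < ‖l 0‖ + ‖l 1‖ ∧ ∀ i j, W i j = s i * l j := by
  rw [Matrix.det_fin_two] at hW
  obtain ⟨j, hj⟩ : ∃ j, W 0 j ≠ 0 ∨ W 1 j ≠ 0 := by
    by_contra! hcon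
    exact h0 (by ext i j; fin_cases i; exacts [(hcon j).1, (hcon j).2])
  set ρ : ℝ := √(‖W 0 j‖ ^ 2 + ‖W 1 j‖ ^ 2) with hρ
  have hpos : 0 < ‖W 0 j‖ ^ 2 + ‖W 1 j‖ ^ 2 := by
    rcases hj with hj | hj
    · have := norm_pos_iff.2 hj; positivity
    · have := norm_pos_iff.2 hj; positivity
  have hρ0 : 0 < ρ := Real.sqrt_pos.2 hpos
  have hρ2 : ρ ^ 2 = ‖W 0 j‖ ^ 2 + ‖W 1 j‖ ^ 2 := Real.sq_sqrt hpos.le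
  have hρc : (ρ : ℂ) ≠ 0 := by exact_mod_cast hρ0.ne'
  have minor : ∀ i i' j k, W i k * W i' j = W i j * W i' k := by
    intro i i' j k
    fin_cases i <;> fin_cases i' <;> fin_cases j <;> fin_cases k <;> simp <;>
      first | ring1 | linear_combination hW | linear_combination -hW
  have hpar : ∃ t : Fin 2 → ℂ, t ≠ 0 ∧ ∀ i k, W i k = W i j * t k := by
    rcases hj with hj | hj
    · refine ⟨fun k => W 0 k / W 0 j, fun h => ?_, ?_⟩
      · have := congrFun h j
        simp [hj] at this
      · intro i k
        rw [mul_div_assoc', eq_div_iff hj]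
        exact minor i 0 j k
    · refine ⟨fun k => W 1 k / W 1 j, fun h => ?_, ?_⟩
      · have := congrFun h j
        simp [hj] at this
      · intro i k
        rw [mul_div_assoc', eq_div_iff hj]
        exact minor i 1 j k
  obtain ⟨t, ht0, ht⟩ := hpar
  refine ⟨fun i => W i j / ρ, fun k => ρ * t k, ?_, ?_, fun i k => ?_⟩
  · simp only [norm_div, Complex.norm_real, Real.norm_eq_abs, div_pow, sq_abs]
    rw [← add_div, hρ2, div_self hpos.ne']
  · have : 0 < ‖t 0‖ + ‖t 1‖ := by
      by_contra! hcon
      have h0 := norm_nonneg (t 0)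
      have h1 := norm_nonneg (t 1)
      refine ht0 (funext fun k => norm_eq_zero.1 ?_)
      fin_cases k
      · exact le_antisymm (by simp only [Fin.zero_eta]; linarith) h0
      · exact le_antisymm (by simp only [Fin.mk_one]; linarith) h1
    rw [norm_mul, norm_mul, ← mul_add]
    exact mul_pos (norm_pos_iff.2 hρc) this
  · rw [ht i k]
    field_simp

/-- If the period matrix of a periodic sequence of numerators has a dominant real eigenvalue, then
the approximants are attracted by the corresponding eigenvector. -/
theorem attracts_of_periodic {a : ℕ → ℂ} {L : ℕ} (hL : 0 < L) (hper : ∀ k, a (k + L) = a k)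
    {μ ν : ℝ} (hμν : |ν| < μ) (htr : (transferMat a L).trace = (μ + ν : ℝ))
    (hdet : (transferMat a L).det = (μ * ν : ℝ)) {G : Set ℝ}
    (hG : ∀ w : Fin 2 → ℂ, (transferMat a L).mulVec w = (μ : ℂ) • w →
      ‖w 0‖ ^ 2 + ‖w 1‖ ^ 2 = 1 → (‖w 0‖ ^ 2 - ‖w 1‖ ^ 2) ^ 2 ∈ G) :
    Attracts (contMat a) G := by
  set N := transferMat a L with hN
  have hμ0 : 0 < μ := (abs_nonneg _).trans_lt hμν
  have hne : μ - ν ≠ 0 := by linarith [le_abs_self ν]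
  have hnec : (μ - ν : ℂ) ≠ 0 := by exact_mod_cast hne
  have hμc : (μ : ℂ) ≠ 0 := by exact_mod_cast hμ0.ne'
  rw [Matrix.trace_fin_two] at htr
  rw [Matrix.det_fin_two] at hdet
  push_cast at htr hdet
  -- Cayley–Hamilton, in the form `(N - μ) * (N - ν) = 0`; it gives the closed form of `N ^ j`
  -- below.
  have hCH : N * (N - (ν : ℂ) • 1) = (μ : ℂ) • (N - (ν : ℂ) • 1) := by
    ext i j
    fin_cases i <;> fin_cases j <;> simp [Matrix.mul_apply, Fin.sum_univ_two]
    · linear_combination N 0 0 * htr - hdet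
    · linear_combination N 0 1 * htr
    · linear_combination N 1 0 * htr
    · linear_combination N 1 1 * htr - hdet
  have hCH' : N * (N - (μ : ℂ) • 1) = (ν : ℂ) • (N - (μ : ℂ) • 1) := by
    ext i j
    fin_cases i <;> fin_cases j <;> simp [Matrix.mul_apply, Fin.sum_univ_two]
    · linear_combination N 0 0 * htr - hdet
    · linear_combination N 0 1 * htr
    · linear_combination N 1 0 * htr
    · linear_combination N 1 1 * htr - hdet
  have hpow : ∀ j : ℕ, (μ - ν : ℂ) • N ^ j =
      (μ : ℂ) ^ j • (N - (ν : ℂ) • 1) - (ν : ℂ) ^ j • (N - (μ : ℂ) • 1) := by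
    intro j
    induction j with
    | zero => simp [sub_smul]
    | succ j ih =>
      rw [pow_succ', ← Matrix.mul_smul, ih, Matrix.mul_sub, Matrix.mul_smul, Matrix.mul_smul, hCH,
        hCH', smul_smul, smul_smul, ← pow_succ, ← pow_succ]
  set W := (N - (ν : ℂ) • 1) * numMat 1 with hW
  set W' := (N - (μ : ℂ) • 1) * numMat 1 with hW'
  have hF : (numMat (1 : ℂ)).det = -1 := by simp [numMat, Matrix.det_fin_two]
  have hWdet : W.det = 0 := by
    rw [hW, Matrix.det_mul, Matrix.det_fin_two]
    simp
    left
    linear_combination -(ν : ℂ) * htr + hdet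
  have hW0 : W ≠ 0 := by
    intro h
    have h1 : N - (ν : ℂ) • 1 = 0 := by
      have : W * (numMat 1)⁻¹ = N - (ν : ℂ) • 1 :=
        Matrix.mul_nonsing_inv_cancel_right _ _ (by rw [hF]; simp)
      rw [← this, h, Matrix.zero_mul]
    have h00 := congrFun (congrFun h1 0) 0
    have h11 := congrFun (congrFun h1 1) 1
    simp at h00 h11
    exact hnec (by linear_combination -htr + h00 + h11)
  obtain ⟨s, l, hs, hl, hsl⟩ := exists_eq_mul_of_det_eq_zero hW0 hWdet
  have hNW : N * W = (μ : ℂ) • W := by rw [hW, ← Matrix.mul_assoc, hCH, Matrix.smul_mul]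
  have heig : N.mulVec s = (μ : ℂ) • s := by
    obtain ⟨j, hj⟩ : ∃ j, l j ≠ 0 := by
      by_contra! hcon
      simp [hcon] at hl
    ext i
    have := congrFun (congrFun hNW i) j
    rw [Matrix.mul_apply, Fin.sum_univ_two, Matrix.smul_apply, hsl, hsl, hsl, smul_eq_mul] at this
    refine mul_right_cancel₀ hj ?_
    rw [Matrix.mulVec, dotProduct, Fin.sum_univ_two, Pi.smul_apply, smul_eq_mul]
    linear_combination this
  have hcont : ∀ j, contMat a (L * j) = N ^ j * numMat 1 := by
    intro j
    rw [contMat, transferMat, prodUpTo_mul_of_periodic (fun k => by rw [hper k])]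
    rfl
  intro ε hε k
  set c : ℝ := (‖l 0‖ + ‖l 1‖)⁻¹ with hc
  have hlim : ∀ i i' : Fin 2,
      Tendsto (fun j : ℕ => ‖(c : ℂ) * ((ν : ℂ) / μ) ^ j * W' i i'‖) atTop (𝓝 0) := by
    intro i i'
    have h1 : Tendsto (fun j : ℕ => ((ν : ℂ) / μ) ^ j) atTop (𝓝 0) := by
      apply tendsto_pow_atTop_nhds_zero_of_norm_lt_one
      rw [norm_div, Complex.norm_real, Complex.norm_real, Real.norm_eq_abs, Real.norm_eq_abs,
        abs_of_pos hμ0, div_lt_one hμ0]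
      exact hμν
    have h2 := ((h1.const_mul (c : ℂ)).mul_const (W' i i')).norm
    simpa using h2
  have hev : ∀ᶠ j : ℕ in atTop, ∀ i i' : Fin 2, ‖(c : ℂ) * ((ν : ℂ) / μ) ^ j * W' i i'‖ < ε :=
    eventually_all.2 fun i => eventually_all.2 fun i' => (hlim i i').eventually_lt_const hε
  obtain ⟨j, hj, hjk⟩ := (hev.and (eventually_ge_atTop k)).exists
  -- Dividing by `μ ^ j` leaves the rank-one `W` plus an error of order `(ν / μ) ^ j`; the factor
  -- `c` normalizes the row vector `l`.
  refine ⟨L * j, le_trans hjk (Nat.le_mul_of_pos_left _ hL), c * (μ - ν) / μ ^ j, s,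
    fun i => c * l i, hs, ?_, hG s heig hs, fun i i' => ?_⟩
  · rw [norm_mul, norm_mul, ← mul_add, Complex.norm_real, Real.norm_eq_abs, hc,
      abs_of_pos (inv_pos.2 hl), inv_mul_cancel₀ hl.ne']
  · have h1 : (μ - ν : ℂ) * contMat a (L * j) i i' = (μ : ℂ) ^ j * W i i' - (ν : ℂ) ^ j * W' i i' := by
      have : (μ - ν : ℂ) • contMat a (L * j) = (μ : ℂ) ^ j • W - (ν : ℂ) ^ j • W' := by
        rw [hcont, ← Matrix.smul_mul, hpow, Matrix.sub_mul, Matrix.smul_mul, Matrix.smul_mul]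
      simpa using congrFun (congrFun this i) i'
    have h2 : (c : ℂ) * (μ - ν) / μ ^ j * contMat a (L * j) i i' - s i * (c * l i') =
        -((c : ℂ) * ((ν : ℂ) / μ) ^ j * W' i i') := by
      have : (c : ℂ) * (μ - ν) / μ ^ j * contMat a (L * j) i i' =
          c / μ ^ j * ((μ - ν) * contMat a (L * j) i i') := by ring
      rw [this, h1, hsl i i', div_pow]
      field_simp
      ring
    rw [h2, norm_neg]
    exact hj i i'

/-! ### Period matrices as values of integer polynomials. -/

theorem aeval_transferMat {S : Type*} [CommRing S] (ζ : S) (a : ℕ → ℤ[X]) (n : ℕ) (i j : Fin 2) :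
    aeval ζ (transferMat a n i j) = transferMat (fun k => aeval ζ (a k)) n i j :=
  congrFun (congrFun (map_transferMat (aeval ζ : ℤ[X] →ₐ[ℤ] S).toRingHom a n) i) j

theorem aeval_contMat {S : Type*} [CommRing S] (ζ : S) (a : ℕ → ℤ[X]) (n : ℕ) (i j : Fin 2) :
    aeval ζ (contMat a n i j) = contMat (fun k => aeval ζ (a k)) n i j := by
  simp only [contMat, Matrix.mul_apply, Fin.sum_univ_two, map_add, map_mul, aeval_transferMat]
  fin_cases j <;> simp [numMat]

/-- The entries of the period matrix of the numerators `a k` at a root of unity `ζ`, together with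
its trace `t` and its determinant `d`. -/
structure PeriodMatrix (a : ℕ → ℤ[X]) (L : ℕ) (c t d : ℝ) (ζ : ℂ) (A R : ℝ) (b : ℂ) : Prop where
  aeval_zero_zero : aeval ζ (transferMat a L 0 0) = A
  aeval_cont : aeval ζ (contMat a (L - 1) 1 1) = R
  aeval_one_zero : aeval ζ (transferMat a L 1 0) = b
  eq : transferMat (fun n => aeval ζ (a n)) L = !![(A : ℂ), c * star b; b, c * R]
  trace : A + c * R = t
  det : c * (A * R - ‖b‖ ^ 2) = d

theorem exists_periodMatrix {a : ℕ → ℤ[X]} {L : ℕ} {c t d : ℝ} {ζ : ℂ} (hL : 0 < L)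
    (hc : aeval ζ (a L) = (c : ℂ))
    (h : ∀ k, 1 ≤ k → k < L → star (aeval ζ (a k)) = aeval ζ (a (L - k)))
    (ht : (transferMat (fun n => aeval ζ (a n)) L).trace = t)
    (hd : (transferMat (fun n => aeval ζ (a n)) L).det = d) :
    ∃ A R b, PeriodMatrix a L c t d ζ A R b := by
  obtain ⟨A, R, hR, b, hN⟩ := exists_transferMat_eq (a := fun n => aeval ζ (a n)) hL h
  rw [hc] at hN
  refine ⟨A, R, b, ?_, ?_, ?_, hN, ?_, ?_⟩
  · rw [aeval_transferMat, hN]; simp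
  · rw [aeval_contMat, hR]
  · rw [aeval_transferMat, hN]; simp
  · rw [hN, Matrix.trace_fin_two] at ht
    simp at ht
    exact_mod_cast ht
  · rw [hN, Matrix.det_fin_two] at hd
    have hb : star b * b = ((‖b‖ ^ 2 : ℝ) : ℂ) := by
      rw [mul_comm]
      push_cast
      exact Complex.mul_conj' b
    simp only [Matrix.of_apply, Matrix.cons_val_zero, Matrix.cons_val_one, Matrix.cons_val',
      Matrix.cons_val_fin_one, mul_assoc, hb] at hd
    have : ((c * (A * R - ‖b‖ ^ 2) : ℝ) : ℂ) = d := by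
      rw [← hd]
      push_cast
      ring
    exact_mod_cast this

theorem PeriodMatrix.attracts {a : ℕ → ℤ[X]} {L : ℕ} {c t d : ℝ} {ζ : ℂ} {A R : ℝ} {b : ℂ}
    (h : PeriodMatrix a L c t d ζ A R b) (hL : 0 < L)
    (hper : ∀ k, aeval ζ (a (k + L)) = aeval ζ (a k)) {μ ν : ℝ} (hμν : |ν| < μ) (ht : t = μ + ν)
    (hd : d = μ * ν) {G : Set ℝ}
    (hG : ∀ w : Fin 2 → ℂ, c * star b * w 1 = (μ - A) * w 0 → b * w 0 = (μ - c * R) * w 1 →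
      ‖w 0‖ ^ 2 + ‖w 1‖ ^ 2 = 1 → (‖w 0‖ ^ 2 - ‖w 1‖ ^ 2) ^ 2 ∈ G) :
    Attracts (contMat fun n => aeval ζ (a n)) G := by
  refine attracts_of_periodic hL hper hμν ?_ ?_ ?_
  · rw [h.eq, Matrix.trace_fin_two, ← ht, ← h.trace]
    simp
  · rw [h.eq, Matrix.det_fin_two, ← hd, ← h.det]
    have hb : star b * b = ((‖b‖ ^ 2 : ℝ) : ℂ) := by
      rw [mul_comm]
      push_cast
      exact Complex.mul_conj' b
    simp only [Matrix.of_apply, Matrix.cons_val_zero, Matrix.cons_val_one, Matrix.cons_val',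
      Matrix.cons_val_fin_one, mul_assoc, hb]
    push_cast
    ring
  · intro w hw hw1
    rw [h.eq] at hw
    have h0 := congrFun hw 0
    have h1 := congrFun hw 1
    simp [Matrix.mulVec, dotProduct, Fin.sum_univ_two] at h0 h1
    refine hG w ?_ ?_ hw1
    · simp only [Complex.star_def]
      linear_combination h0
    · linear_combination h1

/-- The period matrix is diagonal and `μ` cannot be both diagonal entries, since the trace is below
`2 * μ`. The eigenvector is therefore one of the two poles. -/
theorem PeriodMatrix.attracts_one {a : ℕ → ℤ[X]} {L : ℕ} {c t d : ℝ} {ζ : ℂ} {A R : ℝ} {b : ℂ}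
    (h : PeriodMatrix a L c t d ζ A R b) (hL : 0 < L)
    (hper : ∀ k, aeval ζ (a (k + L)) = aeval ζ (a k)) {μ ν : ℝ} (hμν : |ν| < μ) (ht : t = μ + ν)
    (hd : d = μ * ν) (hb : b = 0) : Attracts (contMat fun n => aeval ζ (a n)) {1} := by
  refine h.attracts hL hper hμν ht hd fun w h0 h1 hw => ?_
  rw [hb] at h0 h1
  have h0' : ((μ - A : ℝ) : ℂ) * w 0 = 0 := by push_cast; rw [← h0]; simp
  have h1' : ((μ - c * R : ℝ) : ℂ) * w 1 = 0 := by push_cast; rw [← h1]; simp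
  rcases mul_eq_zero.1 h0' with e0 | e0
  · rcases mul_eq_zero.1 h1' with e1 | e1
    · have e0' : μ - A = 0 := by exact_mod_cast e0
      have e1' : μ - c * R = 0 := by exact_mod_cast e1
      have := h.trace
      linarith [le_abs_self ν]
    · have e : ‖w 1‖ ^ 2 = 0 := by simp [e1]
      rw [Set.mem_singleton_iff, show ‖w 0‖ ^ 2 - ‖w 1‖ ^ 2 = 1 by linarith, one_pow]
  · have e : ‖w 0‖ ^ 2 = 0 := by simp [e0]
    rw [Set.mem_singleton_iff, show ‖w 0‖ ^ 2 - ‖w 1‖ ^ 2 = -1 by linarith]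
    norm_num

theorem norm_sq_mul_eq {b w₀ w₁ : ℂ} {c x : ℝ} (h : c * star b * w₁ = x * w₀) :
    c ^ 2 * ‖b‖ ^ 2 * ‖w₁‖ ^ 2 = x ^ 2 * ‖w₀‖ ^ 2 := by
  have := congrArg (fun z : ℂ => ‖z‖ ^ 2) h
  simpa only [norm_mul, norm_star, Complex.norm_real, Real.norm_eq_abs, mul_pow, sq_abs] using this

/-- The eigenvalues for trace `1` and determinant `-c` are `μ` and `1 - μ`; `μ` runs from the golden
ratio at `c = 1` to `2` at `c = 2`. -/
theorem exists_golden_root {c : ℝ} (h1 : 1 ≤ c) (h2 : c ≤ 2) :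
    ∃ μ : ℝ, μ * (μ - 1) = c ∧ 3 / 2 ≤ μ ∧ μ ≤ 2 := by
  have hs := Real.sq_sqrt (by linarith : 0 ≤ 1 + 4 * c)
  have hs0 := Real.sqrt_nonneg (1 + 4 * c)
  refine ⟨(1 + √(1 + 4 * c)) / 2, by nlinarith, ?_, ?_⟩
  · nlinarith
  · nlinarith

/-! ### Eigenvector heights for trace one. -/

section TraceOne

variable {a : ℕ → ℤ[X]} {m : ℕ} {c : ℝ} {q : ℂ}

theorem PeriodMatrix.mul_eq_of_trace_one (h1 : 1 ≤ c) {ζ : ℂ} {A R : ℝ} {b : ℂ}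
    (h : PeriodMatrix a m c 1 (-c) ζ A R b) : A * R - ‖b‖ ^ 2 = -1 := by
  have hd := h.det
  have : c * (A * R - ‖b‖ ^ 2 + 1) = 0 := by linarith
  rcases mul_eq_zero.1 this with h | h <;> linarith

theorem PeriodMatrix.mul_le_of_trace_one {ζ : ℂ} {A R : ℝ} {b : ℂ}
    (h : PeriodMatrix a m c 1 (-c) ζ A R b) : c * (A * R) ≤ 1 / 4 := by
  have hR : c * R = 1 - A := by linarith [h.trace]
  have : c * (A * R) = A * (1 - A) := by rw [← hR]; ring
  nlinarith [sq_nonneg (A - 1 / 2)]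

/-- Below, `A * R = ‖b‖ ^ 2 - 1 ≥ -1`; above, `c * (A * R) = A * (1 - A) ≤ 1 / 4`. -/
theorem norm_aeval_mul_le_one_of_trace_one (h1 : 1 ≤ c)
    {ζ : ℂ} {A R : ℝ} {b : ℂ} (h : PeriodMatrix a m c 1 (-c) ζ A R b) :
    ‖aeval ζ (transferMat a m 0 0 * contMat a (m - 1) 1 1)‖ ≤ 1 := by
  rw [map_mul, h.aeval_zero_zero, h.aeval_cont, ← Complex.ofReal_mul, Complex.norm_real,
    Real.norm_eq_abs, abs_le]
  have hd' := h.mul_eq_of_trace_one h1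
  refine ⟨by nlinarith [sq_nonneg ‖b‖], ?_⟩
  nlinarith [h.mul_le_of_trace_one]

/-- A nonzero `A * R` is `1` or `-1`. The bound `1 / 4` excludes `1`, and `-1` means `b = 0`. -/
theorem attracts_one_of_trace_one (hm : 0 < m) (h1 : 1 ≤ c) (h2 : c ≤ 2)
    (hper : ∀ k, aeval q (a (k + m)) = aeval q (a k)) (hq : IsPrimitiveRoot q m)
    (H : ∀ ζ : ℂ, IsPrimitiveRoot ζ m → ∃ A R b, PeriodMatrix a m c 1 (-c) ζ A R b)
    (h0 : aeval q (transferMat a m 0 0 * contMat a (m - 1) 1 1) ≠ 0) :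
    Attracts (contMat fun n => aeval q (a n)) {1} := by
  obtain ⟨μ, hμ, hμ1, hμ2⟩ := exists_golden_root h1 h2
  have hnorm := norm_aeval_eq_one_of_norm_le_one hm hq _ (fun ζ hζ => by
    obtain ⟨A, R, b, h⟩ := H ζ hζ
    exact norm_aeval_mul_le_one_of_trace_one h1 h) h0
  obtain ⟨A, R, b, h⟩ := H q hq
  refine h.attracts_one hm hper (μ := μ) (ν := 1 - μ) ?_ (by ring) (by linarith) ?_
  · rw [abs_lt]; constructor <;> linarith
  rw [map_mul, h.aeval_zero_zero, h.aeval_cont, ← Complex.ofReal_mul, Complex.norm_real,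
    Real.norm_eq_abs] at hnorm
  have hd' := h.mul_eq_of_trace_one h1
  have hle := h.mul_le_of_trace_one
  rcases eq_or_eq_neg_of_abs_eq hnorm with h3 | h3
  · rw [h3] at hle
    linarith
  · have : ‖b‖ ^ 2 = 0 := by linarith
    simpa using this

/-- Since `b ≠ 0` excludes `A * R = -1`, the product `A * R` vanishes. Then `‖b‖ = 1` and `A` is `0`
or `1`. -/
theorem attracts_le_of_trace_one (hm : 0 < m) (h1 : 1 ≤ c) (h2 : c ≤ 2)
    (hper : ∀ k, aeval q (a (k + m)) = aeval q (a k)) (hq : IsPrimitiveRoot q m)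
    (H : ∀ ζ : ℂ, IsPrimitiveRoot ζ m → ∃ A R b, PeriodMatrix a m c 1 (-c) ζ A R b)
    (h0 : aeval q (transferMat a m 1 0) ≠ 0) :
    Attracts (contMat fun n => aeval q (a n)) (Set.Iic (9 / 25)) := by
  obtain ⟨μ, hμ, hμ1, hμ2⟩ := exists_golden_root h1 h2
  obtain ⟨A, R, b, h⟩ := H q hq
  have ht := h.trace
  have hd' := h.mul_eq_of_trace_one h1
  have hAR : A * R = 0 := by
    by_contra hne
    have hne' : aeval q (transferMat a m 0 0 * contMat a (m - 1) 1 1) ≠ 0 := by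
      rw [map_mul, h.aeval_zero_zero, h.aeval_cont]
      exact_mod_cast hne
    have hnorm := norm_aeval_eq_one_of_norm_le_one hm hq _ (fun ζ hζ => by
      obtain ⟨A, R, b, h⟩ := H ζ hζ
      exact norm_aeval_mul_le_one_of_trace_one h1 h) hne'
    rw [map_mul, h.aeval_zero_zero, h.aeval_cont, ← Complex.ofReal_mul, Complex.norm_real,
      Real.norm_eq_abs] at hnorm
    have hle := h.mul_le_of_trace_one
    rw [h.aeval_one_zero] at h0
    have hb : 0 < ‖b‖ ^ 2 := by
      have := norm_pos_iff.2 h0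
      positivity
    rcases eq_or_eq_neg_of_abs_eq hnorm with h3 | h3
    · rw [h3] at hle
      linarith
    · linarith
  have hb : ‖b‖ ^ 2 = 1 := by linarith
  refine h.attracts hm hper (μ := μ) (ν := 1 - μ) ?_ (by ring) (by linarith) fun w hw0 _ hw => ?_
  · rw [abs_lt]; constructor <;> linarith
  have hx := norm_sq_mul_eq (x := μ - A) (by push_cast; exact hw0)
  rw [hb, mul_one] at hx
  set x := ‖w 0‖ ^ 2
  set y := ‖w 1‖ ^ 2
  have hx0 : 0 ≤ x := by positivity
  have hy0 : 0 ≤ y := by positivity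
  have hμ0 : 0 < (μ - 1) ^ 2 := pow_pos (by linarith) 2
  have hμ0' : 0 < μ ^ 2 := pow_pos (by linarith) 2
  -- The ratio `x / y` is `(μ - 1) ^ 2` or `μ ^ 2`, and `3 / 2 ≤ μ ≤ 2`. The height is then at most
  -- `(4 - 1) / (4 + 1) = 3 / 5` in absolute value.
  have hxy : x ≤ 4 * y ∧ y ≤ 4 * x := by
    rcases mul_eq_zero.1 hAR with hA | hR
    · rw [hA, sub_zero, ← hμ] at hx
      have : x = (μ - 1) ^ 2 * y := by
        apply mul_left_cancel₀ hμ0'.ne'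
        linarith
      constructor <;> nlinarith
    · have hA : A = 1 := by rw [hR] at ht; linarith
      rw [hA, ← hμ] at hx
      have : x = μ ^ 2 * y := by
        apply mul_left_cancel₀ hμ0.ne'
        linarith
      constructor <;> nlinarith
  rw [Set.mem_Iic]
  have e1 : x - y ≤ 3 / 5 := by linarith
  have e2 : -(3 / 5) ≤ x - y := by linarith
  nlinarith

end TraceOne

/-! ### Eigenvector heights for traces two and four. -/

section PairTrace

variable {a : ℕ → ℤ[X]} {m L : ℕ} {q : ℂ}

/-- Here `‖b‖ ^ 2 = A * (2 - A) / 2 ≤ 1 / 2` at every conjugate, too small for a nonzero algebraic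
integer, so `b = 0`. -/
theorem attracts_one_of_trace_two (hm : 0 < m) (hL : 0 < L)
    (hper : ∀ k, aeval q (a (k + L)) = aeval q (a k)) (hq : IsPrimitiveRoot q m)
    (H : ∀ ζ : ℂ, IsPrimitiveRoot ζ m → ∃ A R b, PeriodMatrix a L 2 2 0 ζ A R b) :
    Attracts (contMat fun n => aeval q (a n)) {1} := by
  have hbd : ∀ {ζ A R b}, PeriodMatrix a L 2 2 0 ζ A R b → ‖b‖ ^ 2 ≤ 1 / 2 :=
    fun {ζ A R b} h => by
      have ht := h.trace
      have hd := h.det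
      have : R = (2 - A) / 2 := by linarith
      rw [this] at hd
      nlinarith [sq_nonneg (A - 1)]
  obtain ⟨A, R, b, h⟩ := H q hq
  refine h.attracts_one hL hper (μ := 2) (ν := 0) (by norm_num) (by norm_num) (by norm_num) ?_
  by_contra hb
  have hnorm := norm_aeval_eq_one_of_norm_le_one hm hq (transferMat a L 1 0) (fun ζ hζ => by
    obtain ⟨A, R, b, h⟩ := H ζ hζ
    rw [h.aeval_one_zero]
    nlinarith [hbd h, norm_nonneg b]) (by rwa [h.aeval_one_zero])
  rw [h.aeval_one_zero] at hnorm
  have := hbd h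
  rw [hnorm] at this
  norm_num at this

theorem abs_two_sub_sqrt_two_lt : |2 - √2| < 2 + √2 := by
  have := Real.sqrt_pos.2 (by norm_num : (0 : ℝ) < 2)
  rw [abs_lt]
  constructor <;> linarith

/-- The identity `‖b‖ ^ 2 = 1 - (A - 2) ^ 2 / 2` and `b ≠ 0` force `‖b‖ = 1` and `A = 2`, giving
height `1 / 3`. -/
theorem attracts_of_trace_four (hm : 0 < m) (hL : 0 < L)
    (hper : ∀ k, aeval q (a (k + L)) = aeval q (a k)) (hq : IsPrimitiveRoot q m)
    (H : ∀ ζ : ℂ, IsPrimitiveRoot ζ m → ∃ A R b, PeriodMatrix a L 2 4 2 ζ A R b)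
    (h0 : aeval q (transferMat a L 1 0) ≠ 0) :
    Attracts (contMat fun n => aeval q (a n)) (Set.Iic (9 / 25)) := by
  have hbd : ∀ {ζ A R b}, PeriodMatrix a L 2 4 2 ζ A R b → ‖b‖ ^ 2 = 1 - (A - 2) ^ 2 / 2 :=
    fun {ζ A R b} h => by
      have ht := h.trace
      have hd := h.det
      have : R = (4 - A) / 2 := by linarith
      rw [this] at hd
      linarith
  have hnorm := norm_aeval_eq_one_of_norm_le_one hm hq (transferMat a L 1 0) (fun ζ hζ => by
    obtain ⟨A, R, b, h⟩ := H ζ hζ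
    rw [h.aeval_one_zero]
    nlinarith [hbd h, norm_nonneg b, sq_nonneg (A - 2)]) h0
  obtain ⟨A, R, b, h⟩ := H q hq
  rw [h.aeval_one_zero] at hnorm
  have hA2 := hbd h
  rw [hnorm] at hA2
  have hA : A = 2 := by
    have : (A - 2) ^ 2 = 0 := by linarith
    have := pow_eq_zero_iff (two_ne_zero) |>.1 this
    linarith
  have hs : √2 ^ 2 = (2 : ℝ) := Real.sq_sqrt (by norm_num)
  refine h.attracts hL hper abs_two_sub_sqrt_two_lt (by ring) (by nlinarith) fun w hw0 _ hw => ?_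
  have hx := norm_sq_mul_eq (c := 2) (x := 2 + √2 - A) (by push_cast at hw0 ⊢; exact hw0)
  rw [hnorm, hA, show (2 + √2 - 2 : ℝ) ^ 2 = 2 by linear_combination hs] at hx
  have e : ‖w 0‖ ^ 2 - ‖w 1‖ ^ 2 = 1 / 3 := by linarith
  rw [e, Set.mem_Iic]
  norm_num

/-- Both alternatives are acceptable: `b = 0` puts the eigenvector at a pole, and otherwise `‖b‖ =
1`, `A = 1` put it on the equator. No nonvanishing test is needed. -/
theorem attracts_zero_one_of_trace_two (hm : 0 < m) (hL : 0 < L)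
    (hper : ∀ k, aeval q (a (k + L)) = aeval q (a k)) (hq : IsPrimitiveRoot q m)
    (H : ∀ ζ : ℂ, IsPrimitiveRoot ζ m → ∃ A R b, PeriodMatrix a L 1 2 0 ζ A R b) :
    Attracts (contMat fun n => aeval q (a n)) {0, 1} := by
  have hbd : ∀ {ζ A R b}, PeriodMatrix a L 1 2 0 ζ A R b → ‖b‖ ^ 2 = 1 - (A - 1) ^ 2 :=
    fun {ζ A R b} h => by
      have ht := h.trace
      have hd := h.det
      have : R = 2 - A := by linarith
      rw [this] at hd
      linarith
  obtain ⟨A, R, b, h⟩ := H q hq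
  by_cases hb : b = 0
  · intro ε hε k
    obtain ⟨n, hn, κ, s, l, e1, e2, e3, e4⟩ :=
      h.attracts_one hL hper (μ := 2) (ν := 0) (by norm_num) (by norm_num) (by norm_num) hb ε hε k
    exact ⟨n, hn, κ, s, l, e1, e2, Or.inr e3, e4⟩
  have hnorm := norm_aeval_eq_one_of_norm_le_one hm hq (transferMat a L 1 0) (fun ζ hζ => by
    obtain ⟨A, R, b, h⟩ := H ζ hζ
    rw [h.aeval_one_zero]
    nlinarith [hbd h, norm_nonneg b, sq_nonneg (A - 1)]) (by rwa [h.aeval_one_zero])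
  rw [h.aeval_one_zero] at hnorm
  have hA2 := hbd h
  rw [hnorm] at hA2
  have hA : A = 1 := by
    have : (A - 1) ^ 2 = 0 := by linarith
    have := pow_eq_zero_iff (two_ne_zero) |>.1 this
    linarith
  refine h.attracts hL hper (μ := 2) (ν := 0) (by norm_num) (by norm_num) (by norm_num)
    fun w hw0 _ hw => Or.inl ?_
  have hx := norm_sq_mul_eq (c := 1) (x := 2 - A) (by push_cast at hw0 ⊢; exact hw0)
  rw [hnorm, hA] at hx
  have e : ‖w 0‖ ^ 2 - ‖w 1‖ ^ 2 = 0 := by linarith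
  rw [e]
  norm_num

/-- With `x = (A - 2) ^ 2` one has `‖b‖ ^ 2 = 2 - x`, and `x * (2 - x) ≤ 1` with equality only at `x
= 1`. Neither factor alone is bounded by `1`, hence the product. -/
theorem attracts_half_of_trace_four (hm : 0 < m) (hL : 0 < L)
    (hper : ∀ k, aeval q (a (k + L)) = aeval q (a k)) (hq : IsPrimitiveRoot q m)
    (H : ∀ ζ : ℂ, IsPrimitiveRoot ζ m → ∃ A R b, PeriodMatrix a L 1 4 2 ζ A R b)
    (h0 : aeval q ((transferMat a L 0 0 - 2) * transferMat a L 1 0) ≠ 0) :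
    Attracts (contMat fun n => aeval q (a n)) {1 / 2} := by
  have hbd : ∀ {ζ A R b}, PeriodMatrix a L 1 4 2 ζ A R b → ‖b‖ ^ 2 = 2 - (A - 2) ^ 2 :=
    fun {ζ A R b} h => by
      have ht := h.trace
      have hd := h.det
      have : R = 4 - A := by linarith
      rw [this] at hd
      linarith
  have hval : ∀ {ζ A R b}, PeriodMatrix a L 1 4 2 ζ A R b →
      ‖aeval ζ ((transferMat a L 0 0 - 2) * transferMat a L 1 0)‖ ^ 2 =
        (A - 2) ^ 2 * (2 - (A - 2) ^ 2) := fun {ζ A R b} h => by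
    rw [map_mul, map_sub, h.aeval_zero_zero, h.aeval_one_zero, norm_mul, mul_pow, hbd h]
    congr 1
    rw [map_ofNat, show (A : ℂ) - 2 = ((A - 2 : ℝ) : ℂ) by push_cast; rfl, Complex.norm_real,
      Real.norm_eq_abs, sq_abs]
  have hnorm := norm_aeval_eq_one_of_norm_le_one hm hq _ (fun ζ hζ => by
    obtain ⟨A, R, b, h⟩ := H ζ hζ
    have := hval h
    rw [← abs_of_nonneg (norm_nonneg (aeval ζ _)), ← sq_le_one_iff_abs_le_one, this]
    nlinarith [sq_nonneg ((A - 2) ^ 2 - 1)]) h0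
  obtain ⟨A, R, b, h⟩ := H q hq
  have hA2 := hval h
  rw [hnorm] at hA2
  have hA : (A - 2) ^ 2 = 1 := by
    have : ((A - 2) ^ 2 - 1) ^ 2 = 0 := by nlinarith
    have := pow_eq_zero_iff (two_ne_zero) |>.1 this
    linarith
  have hb := hbd h
  rw [hA] at hb
  have hs : √2 ^ 2 = (2 : ℝ) := Real.sq_sqrt (by norm_num)
  refine h.attracts hL hper abs_two_sub_sqrt_two_lt (by ring) (by nlinarith) fun w hw0 _ hw => ?_
  have hx := norm_sq_mul_eq (c := 1) (x := 2 + √2 - A) (by push_cast at hw0 ⊢; exact hw0)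
  rw [hb] at hx
  set x := ‖w 0‖ ^ 2
  set y := ‖w 1‖ ^ 2
  set k := (2 + √2 - A) ^ 2 with hk
  -- As `A - 2 = ±1`, `k = 3 ∓ 2√2`; the equation says `((1 - k) / (1 + k)) ^ 2 = 1 / 2`.
  have hk6 : k ^ 2 - 6 * k + 1 = 0 := by
    have e : k = 3 - 2 * √2 * (A - 2) := by
      rw [hk]
      linear_combination hA + hs
    rw [e]
    linear_combination 4 * √2 ^ 2 * hA + 4 * hs
  have hy : y = k * x := by linarith
  rw [Set.mem_singleton_iff]
  have h3 : (x - y) ^ 2 * 2 = (x + y) ^ 2 := by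
    rw [hy]
    linear_combination x ^ 2 * hk6
  rw [hw] at h3
  linarith

end PairTrace

/-! ### Conjugation of roots of unity and reduction modulo primes. -/

instance fact_prime_five : Fact (Nat.Prime 5) := ⟨by norm_num⟩

theorem pow_add_eq_of_pow_eq_one {ζ : ℂ} {m : ℕ} (h : ζ ^ m = 1) (k c : ℕ) :
    ζ ^ (k + c * m) = ζ ^ k := by
  rw [pow_add, mul_comm c, pow_mul, h, one_pow, mul_one]

theorem star_pow_eq {ζ : ℂ} {m : ℕ} (hm : m ≠ 0) (hζ : ζ ^ m = 1) {k n : ℕ}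
    (h : ζ ^ (k + n) = 1) : star (ζ ^ k) = ζ ^ n := by
  have h1 : ‖ζ‖ = 1 := Complex.norm_eq_one_of_pow_eq_one hζ hm
  have h2 : star (ζ ^ k) * ζ ^ k = 1 := by
    rw [Complex.star_def, Complex.conj_mul', norm_pow, h1]
    simp
  have h3 : ζ ^ k * ζ ^ n = 1 := by rw [← pow_add, h]
  linear_combination ζ ^ n * h2 - star (ζ ^ k) * h3

theorem prodUpTo_smul {f : ℕ → Matrix (Fin 2) (Fin 2) ℂ} (c : ℕ → ℂ) (n : ℕ) :
    prodUpTo (fun k => c k • f k) n = (∏ i ∈ Finset.range n, c (i + 1)) • prodUpTo f n := by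
  induction n with
  | zero => simp [prodUpTo]
  | succ n ih =>
    rw [prodUpTo, ih, prodUpTo, Finset.prod_range_succ, Matrix.smul_mul, Matrix.mul_smul, smul_smul]

theorem contMat_mul_eq {R : Type*} [CommRing R] (a : ℕ → R) {L : ℕ} (hL : 0 < L) :
    contMat a (L - 1) 1 1 * a L = transferMat a L 1 1 := by
  obtain ⟨n, rfl⟩ : ∃ l, L = l + 1 := ⟨L - 1, by omega⟩
  rw [transferMat_succ_eq]
  simp [Matrix.mul_apply, Fin.sum_univ_two]

theorem aeval_mul_ne_zero_of_eval_one {p : ℕ} [Fact p.Prime] {k : ℕ} {q : ℂ} {a : ℕ → ℤ[X]}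
    (hq : IsPrimitiveRoot q (p ^ (k + 1)))
    (h0 : transferMat (fun n => aeval (1 : ZMod p) (a n)) (p ^ (k + 1)) 0 0 ≠ 0)
    (h1 : transferMat (fun n => aeval (1 : ZMod p) (a n)) (p ^ (k + 1)) 1 1 ≠ 0) :
    aeval q (transferMat a (p ^ (k + 1)) 0 0 * contMat a (p ^ (k + 1) - 1) 1 1) ≠ 0 := by
  refine aeval_ne_zero_of_eval_one_ne_zero hq _ ?_
  rw [map_mul, aeval_transferMat, aeval_contMat]
  refine mul_ne_zero h0 fun h => h1 ?_
  rw [← contMat_mul_eq _ (pow_pos (Fact.out : p.Prime).pos _), h, zero_mul]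

theorem pow_prime_pow_fixed {M : Type*} [Monoid M] {x y : M} {p : ℕ} (h1 : x ^ p = y)
    (h2 : y ^ p = y) (k : ℕ) : x ^ p ^ (k + 1) = y := by
  induction k with
  | zero => simpa using h1
  | succ k ih => rw [pow_succ, pow_mul, ih, h2]

theorem pow_prime_pow_alternating {M : Type*} [Monoid M] {x y : M} {p : ℕ} (h1 : x ^ p = y)
    (h2 : y ^ p = x) (k : ℕ) : x ^ p ^ k = x ∨ x ^ p ^ k = y := by
  induction k with
  | zero => simp
  | succ k ih =>
    rw [pow_succ, pow_mul]
    rcases ih with ih | ih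
    · exact Or.inr (by rw [ih, h1])
    · exact Or.inl (by rw [ih, h2])

/-! ### Rogers–Ramanujan: orders `5 ^ n` and `2 ^ n`. -/

section RogersRamanujan

theorem exists_periodMatrix_rogersRamanujan {m : ℕ} (hm : 0 < m) {ζ : ℂ}
    (hζ : IsPrimitiveRoot ζ m) :
    ∃ A R b, PeriodMatrix (fun n => X ^ n) m 1 1 (-1) ζ A R b := by
  refine exists_periodMatrix hm (by simp [hζ.pow_eq_one]) ?_ ?_ ?_
  · intro k _ hk
    simp only [map_pow, aeval_X]
    exact star_pow_eq hm.ne' hζ.pow_eq_one (by rw [Nat.add_sub_cancel' hk.le, hζ.pow_eq_one])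
  · have h := trace_transferMat_eq_one (e := 1) hm hζ (P := X) (by simp) natDegree_X_le (by omega)
    simpa using h
  · rw [det_transferMat]
    have h := prod_range_succ_sub_primitiveRoot hm hζ 0 1
    simpa [hm.ne'] using h

theorem dense_rogersRamanujan_five :
    Dense {θ : ℝ | Attracts (contMat fun n => circlePoint θ ^ n) {1}} := by
  refine dense_of_isPrimitiveRoot (b := 5) (c := 1) (by norm_num) (by norm_num) 1 fun n hn θ hθ => ?_
  obtain ⟨k, rfl⟩ : ∃ k, n = k + 1 := ⟨n - 1, by omega⟩
  rw [one_mul] at hθ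
  -- With `q` replaced by `1` the period matrix is a power of the Fibonacci matrix, whose fifth
  -- power is `3` modulo `5`, and `3 ^ 5 = 3` there.
  have hmod : transferMat (fun n => aeval (1 : ZMod 5) (X ^ n : ℤ[X])) (5 ^ (k + 1)) =
      !![3, 0; 0, 3] := by
    simp only [map_pow, aeval_X, one_pow]
    rw [transferMat_const]
    exact pow_prime_pow_fixed (by decide) (by decide) k
  have h := attracts_one_of_trace_one (a := fun n => X ^ n) (c := 1) (by positivity) le_rfl
    (by norm_num) (fun k => by
      simpa using pow_add_eq_of_pow_eq_one hθ.pow_eq_one k 1) hθ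
    (fun ζ hζ => exists_periodMatrix_rogersRamanujan (by positivity) hζ)
    (aeval_mul_ne_zero_of_eval_one hθ (by rw [hmod]; decide) (by rw [hmod]; decide))
  simpa using h

theorem dense_rogersRamanujan_two :
    Dense {θ : ℝ | Attracts (contMat fun n => circlePoint θ ^ n) (Set.Iic (9 / 25))} := by
  refine dense_of_isPrimitiveRoot (b := 2) (c := 1) (by norm_num) (by norm_num) 1 fun n hn θ hθ => ?_
  obtain ⟨k, rfl⟩ : ∃ k, n = k + 1 := ⟨n - 1, by omega⟩
  rw [one_mul] at hθ
  have hmod : transferMat (fun n => aeval (1 : ZMod 2) (X ^ n : ℤ[X])) (2 ^ (k + 1)) 1 0 ≠ 0 := by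
    simp only [map_pow, aeval_X, one_pow]
    rw [transferMat_const]
    -- Modulo `2`, squaring swaps the Fibonacci matrix and its square, both with nonzero lower left
    -- entry.
    rcases pow_prime_pow_alternating (x := numMat (1 : ZMod 2)) (y := !![0, 1; 1, 1]) (p := 2)
      (by decide) (by decide) (k + 1) with h | h <;> rw [h] <;> decide
  have h := attracts_le_of_trace_one (a := fun n => X ^ n) (c := 1) (by positivity) le_rfl
    (by norm_num) (fun k => by
      simpa using pow_add_eq_of_pow_eq_one hθ.pow_eq_one k 1) hθ
    (fun ζ hζ => exists_periodMatrix_rogersRamanujan (by positivity) hζ)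
    (aeval_ne_zero_of_eval_one_ne_zero hθ _ (by rwa [aeval_transferMat]))
  simpa using h

end RogersRamanujan

/-! ### Third Ramanujan–Selberg fraction: orders `3 ^ n` and `5 ^ n`. -/

section RamanujanSelbergThree

theorem exists_periodMatrix_ramanujanSelberg₃ {m : ℕ} (hm : Odd m) {ζ : ℂ}
    (hζ : IsPrimitiveRoot ζ m) :
    ∃ A R b, PeriodMatrix (fun n => X ^ n + X ^ (2 * n)) m 2 1 (-2) ζ A R b := by
  have hm0 := hm.pos
  refine exists_periodMatrix hm0 ?_ ?_ ?_ ?_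
  · simp only [map_add, map_pow, aeval_X, mul_comm 2 m, pow_mul, hζ.pow_eq_one, one_pow]
    norm_num
  · intro k _ hk
    simp only [map_add, map_pow, aeval_X, star_add]
    rw [star_pow_eq (n := m - k) hm0.ne' hζ.pow_eq_one,
      star_pow_eq (n := 2 * (m - k)) hm0.ne' hζ.pow_eq_one]
    · rw [← mul_add, Nat.add_sub_cancel' hk.le, mul_comm, pow_mul, hζ.pow_eq_one, one_pow]
    · rw [Nat.add_sub_cancel' hk.le, hζ.pow_eq_one]
  -- For numerators of degree two the bound `2 * (m / 2) < m` holds exactly when the order is odd.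
  · have h := trace_transferMat_eq_one (e := 2) hm0 hζ (P := X + X ^ 2) (by simp)
      (by compute_degree) (by obtain ⟨l, rfl⟩ := hm; omega)
    simpa [← pow_mul, mul_comm] using h
  · rw [det_transferMat]
    have h1 := prod_range_succ_sub_primitiveRoot hm0 hζ 0 1
    have h2 := prod_range_succ_sub_primitiveRoot hm0 hζ 1 (-1)
    have h3 : ∀ i ∈ Finset.range m, -aeval ζ (X ^ (i + 1) + X ^ (2 * (i + 1)) : ℤ[X]) =
        (0 - ζ ^ (i + 1) * 1) * (1 - ζ ^ (i + 1) * (-1)) := by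
      intro i _
      simp only [map_add, map_pow, aeval_X]
      ring
    rw [Finset.prod_congr rfl h3, Finset.prod_mul_distrib, h1, h2, hm.neg_one_pow,
      zero_pow hm0.ne']
    norm_num

theorem dense_ramanujanSelberg₃_three :
    Dense {θ : ℝ | Attracts (contMat fun n => circlePoint θ ^ n + circlePoint θ ^ (2 * n)) {1}} := by
  refine dense_of_isPrimitiveRoot (b := 3) (c := 1) (by norm_num) (by norm_num) 1 fun n hn θ hθ => ?_
  obtain ⟨k, rfl⟩ : ∃ k, n = k + 1 := ⟨n - 1, by omega⟩
  rw [one_mul] at hθ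
  have hmod : transferMat (fun n => aeval (1 : ZMod 3) (X ^ n + X ^ (2 * n) : ℤ[X])) (3 ^ (k + 1)) =
      !![2, 0; 0, 2] := by
    simp only [map_add, map_pow, aeval_X, one_pow]
    rw [transferMat_const]
    exact pow_prime_pow_fixed (by decide) (by decide) k
  have h := attracts_one_of_trace_one (a := fun n => X ^ n + X ^ (2 * n)) (c := 2) (by positivity)
    (by norm_num) le_rfl (fun k => by
      have h1 := pow_add_eq_of_pow_eq_one hθ.pow_eq_one k 1
      have h2 := pow_add_eq_of_pow_eq_one hθ.pow_eq_one (2 * k) 2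
      rw [one_mul] at h1
      simp only [map_add, map_pow, aeval_X, mul_add, h1, h2]) hθ
    (fun ζ hζ => exists_periodMatrix_ramanujanSelberg₃ (Odd.pow (by decide)) hζ)
    (aeval_mul_ne_zero_of_eval_one hθ (by rw [hmod]; decide) (by rw [hmod]; decide))
  simpa using h

theorem dense_ramanujanSelberg₃_five :
    Dense {θ : ℝ | Attracts (contMat fun n => circlePoint θ ^ n + circlePoint θ ^ (2 * n))
      (Set.Iic (9 / 25))} := by
  refine dense_of_isPrimitiveRoot (b := 5) (c := 1) (by norm_num) (by norm_num) 1 fun n hn θ hθ => ?_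
  obtain ⟨k, rfl⟩ : ∃ k, n = k + 1 := ⟨n - 1, by omega⟩
  rw [one_mul] at hθ
  have hmod : transferMat (fun n => aeval (1 : ZMod 5) (X ^ n + X ^ (2 * n) : ℤ[X])) (5 ^ (k + 1)) =
      !![1, 2; 1, 0] := by
    simp only [map_add, map_pow, aeval_X, one_pow]
    rw [transferMat_const]
    exact pow_prime_pow_fixed (by decide) (by decide) k
  have h := attracts_le_of_trace_one (a := fun n => X ^ n + X ^ (2 * n)) (c := 2) (by positivity)
    (by norm_num) le_rfl (fun k => by
      have h1 := pow_add_eq_of_pow_eq_one hθ.pow_eq_one k 1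
      have h2 := pow_add_eq_of_pow_eq_one hθ.pow_eq_one (2 * k) 2
      rw [one_mul] at h1
      simp only [map_add, map_pow, aeval_X, mul_add, h1, h2]) hθ
    (fun ζ hζ => exists_periodMatrix_ramanujanSelberg₃ (Odd.pow (by decide)) hζ)
    (aeval_ne_zero_of_eval_one_ne_zero hθ _ (by rw [aeval_transferMat, hmod]; decide))
  simpa using h

end RamanujanSelbergThree

/-! ### First and second Ramanujan–Selberg fractions, in pairs of numerators. -/

theorem transferMat_two_mul {a : ℕ → ℂ} {c : ℕ → ℂ} {f : ℕ → Matrix (Fin 2) (Fin 2) ℂ} {r : ℕ}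
    (h : ∀ k, numMat (a (2 * k + 1)) * numMat (a (2 * (k + 1))) = c (k + 1) • f (k + 1))
    (hc : ∏ i ∈ Finset.range r, c (i + 1) = 1) : transferMat a (2 * r) = prodUpTo f r := by
  rw [transferMat, prodUpTo_two_mul]
  have : prodUpTo (fun k => numMat (a (2 * k - 1)) * numMat (a (2 * k))) r =
      prodUpTo (fun k => c k • f k) r := by
    refine prodUpTo_congr fun k hk _ => ?_
    obtain ⟨l, rfl⟩ : ∃ l, k = l + 1 := ⟨k - 1, by omega⟩
    rw [← h l]
    rfl
  rw [this, prodUpTo_smul, hc, one_smul]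

theorem transferMat_two_mul_mod {R : Type*} [CommRing R] {a : ℕ → R} {x y : R}
    (hx : ∀ k, a (2 * k + 1) = x) (hy : ∀ k, a (2 * k) = y) (r : ℕ) :
    transferMat a (2 * r) = (numMat x * numMat y) ^ r := by
  rw [transferMat, prodUpTo_two_mul, ← prodUpTo_const]
  refine prodUpTo_congr fun k hk _ => ?_
  obtain ⟨l, rfl⟩ : ∃ l, k = l + 1 := ⟨k - 1, by omega⟩
  rw [hy, show 2 * (l + 1) - 1 = 2 * l + 1 by omega, hx]

section RamanujanSelbergOne

/-- The numerators of the first Ramanujan–Selberg continued fraction. -/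
def selbergNum₁ {R : Type*} [CommRing R] (q : R) (n : ℕ) : R :=
  if Odd n then q ^ n else q ^ (n / 2) + q ^ n

theorem selbergNum₁_odd {R : Type*} [CommRing R] (q : R) (k : ℕ) :
    selbergNum₁ q (2 * k + 1) = q ^ (2 * k + 1) := by
  simp [selbergNum₁]

theorem selbergNum₁_even {R : Type*} [CommRing R] (q : R) (k : ℕ) :
    selbergNum₁ q (2 * k) = q ^ k + q ^ (2 * k) := by
  simp [selbergNum₁]

theorem aeval_selbergNum₁ {S : Type*} [CommRing S] (ζ : S) (n : ℕ) :
    aeval ζ (selbergNum₁ (X : ℤ[X]) n) = selbergNum₁ ζ n := by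
  unfold selbergNum₁
  split_ifs <;> simp

theorem trace_det_selbergNum₁ {m : ℕ} (hm : 3 ≤ m) {ζ : ℂ} (hζ : IsPrimitiveRoot ζ m) :
    (transferMat (selbergNum₁ ζ) (2 * m)).trace = 3 - (-1) ^ m ∧
      (transferMat (selbergNum₁ ζ) (2 * m)).det = 1 - (-1) ^ m := by
  have hζ0 : ζ ≠ 0 := hζ.ne_zero (by omega)
  -- Dividing the `k`-th pair by `ζ ^ (2 * k)` gives the quadratic matrix polynomial at powers of `p
  -- = ζ⁻¹`, with `β = γ = η = 1`; the scalars multiply to `1`.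
  rw [transferMat_two_mul (c := fun k => (ζ ^ 2) ^ k) (f := fun k =>
    !![ζ⁻¹ + 0 * ζ⁻¹ ^ k + (ζ⁻¹ ^ k) ^ 2, 1 + 1 * ζ⁻¹ ^ k; (ζ⁻¹ ^ k) ^ 2, 1 + 1 * ζ⁻¹ ^ k])
    ?_ (prod_range_pow_succ hζ)]
  · exact trace_det_prodUpTo_pair hm hζ.inv fun z => by ring
  · intro k
    rw [selbergNum₁_odd, selbergNum₁_even]
    ext i j
    fin_cases i <;> fin_cases j <;>
      simp [numMat, Matrix.mul_apply, Fin.sum_univ_two] <;> field_simp <;> ring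

theorem selbergNum₁_add_period {m : ℕ} {ζ : ℂ} (hζ : ζ ^ m = 1) (k : ℕ) :
    selbergNum₁ ζ (k + 2 * m) = selbergNum₁ ζ k := by
  rcases Nat.even_or_odd' k with ⟨l, rfl | rfl⟩
  · have h1 := pow_add_eq_of_pow_eq_one hζ l 1
    have h2 := pow_add_eq_of_pow_eq_one hζ (2 * l) 2
    rw [one_mul] at h1
    rw [← mul_add, selbergNum₁_even, selbergNum₁_even, mul_add, h1, h2]
  · have h2 := pow_add_eq_of_pow_eq_one hζ (2 * l + 1) 2
    rw [show 2 * l + 1 + 2 * m = 2 * (l + m) + 1 by ring, selbergNum₁_odd, selbergNum₁_odd, ← h2]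
    ring

theorem star_selbergNum₁ {m : ℕ} {ζ : ℂ} (hm : m ≠ 0) (hζ : ζ ^ m = 1) {k : ℕ} (hk : k < 2 * m) :
    star (selbergNum₁ ζ k) = selbergNum₁ ζ (2 * m - k) := by
  have h2 : ζ ^ (2 * m) = 1 := by rw [mul_comm, pow_mul, hζ, one_pow]
  rcases Nat.even_or_odd' k with ⟨l, rfl | rfl⟩
  · rw [← Nat.mul_sub, selbergNum₁_even, selbergNum₁_even, star_add,
      star_pow_eq (n := m - l) hm hζ, star_pow_eq (n := 2 * (m - l)) hm hζ]
    · rw [← mul_add, Nat.add_sub_cancel' (by omega), h2]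
    · rw [Nat.add_sub_cancel' (by omega), hζ]
  · rw [show 2 * m - (2 * l + 1) = 2 * (m - l - 1) + 1 by omega, selbergNum₁_odd, selbergNum₁_odd,
      star_pow_eq hm hζ]
    rw [show 2 * l + 1 + (2 * (m - l - 1) + 1) = 2 * m by omega, h2]

theorem exists_periodMatrix_selbergNum₁ {m : ℕ} (hm : 3 ≤ m) {ζ : ℂ} (hζ : IsPrimitiveRoot ζ m)
    {t d : ℝ} (ht : (t : ℂ) = 3 - (-1) ^ m) (hd : (d : ℂ) = 1 - (-1) ^ m) :
    ∃ A R b, PeriodMatrix (selbergNum₁ X) (2 * m) 2 t d ζ A R b := by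
  have h := trace_det_selbergNum₁ hm hζ
  refine exists_periodMatrix (by omega) ?_ ?_ ?_ ?_ <;> simp only [aeval_selbergNum₁]
  · rw [selbergNum₁_even, mul_comm 2 m, pow_mul, hζ.pow_eq_one]
    norm_num
  · intro k _ hk
    exact star_selbergNum₁ (by omega) hζ.pow_eq_one hk
  · rw [ht]; exact h.1
  · rw [hd]; exact h.2

theorem dense_selbergNum₁_two :
    Dense {θ : ℝ | Attracts (contMat (selbergNum₁ (circlePoint θ))) {1}} := by
  refine dense_of_isPrimitiveRoot (b := 2) (c := 1) (by norm_num) (by norm_num) 2 fun n hn θ hθ => ?_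
  rw [one_mul] at hθ
  have hm : 3 ≤ 2 ^ n := le_trans (by norm_num) (Nat.pow_le_pow_right (by norm_num) hn : 2 ^ 2 ≤ 2 ^ n)
  have heven : Even (2 ^ n) := (by decide : Even 2).pow_of_ne_zero (by omega)
  have h := attracts_one_of_trace_two (a := selbergNum₁ X) (m := 2 ^ n) (L := 2 * 2 ^ n)
    (by omega) (by omega)
    (fun k => by rw [aeval_selbergNum₁, aeval_selbergNum₁, selbergNum₁_add_period hθ.pow_eq_one]) hθ
    (fun ζ hζ => exists_periodMatrix_selbergNum₁ hm hζ (by rw [heven.neg_one_pow]; norm_num)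
      (by rw [heven.neg_one_pow]; norm_num))
  simp only [aeval_selbergNum₁] at h
  exact h

theorem dense_selbergNum₁_three :
    Dense {θ : ℝ | Attracts (contMat (selbergNum₁ (circlePoint θ))) (Set.Iic (9 / 25))} := by
  refine dense_of_isPrimitiveRoot (b := 3) (c := 1) (by norm_num) (by norm_num) 1 fun n hn θ hθ => ?_
  obtain ⟨k, rfl⟩ : ∃ k, n = k + 1 := ⟨n - 1, by omega⟩
  rw [one_mul] at hθ
  have hm : 3 ≤ 3 ^ (k + 1) := Nat.le_self_pow (by omega) 3
  have hodd : Odd (3 ^ (k + 1)) := Odd.pow (by decide)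
  have hmod : transferMat (fun n => aeval (1 : ZMod 3) (selbergNum₁ (X : ℤ[X]) n))
      (2 * 3 ^ (k + 1)) 1 0 ≠ 0 := by
    rw [transferMat_two_mul_mod (x := 1) (y := 2)]
    · rcases pow_prime_pow_alternating (x := numMat (1 : ZMod 3) * numMat 2)
        (y := !![2, 1; 2, 2]) (p := 3) (by decide) (by decide) (k + 1) with h | h <;>
        rw [h] <;> decide
    · intro k
      rw [aeval_selbergNum₁, selbergNum₁_odd, one_pow]
    · intro k
      rw [aeval_selbergNum₁, selbergNum₁_even, one_pow, one_pow]
      rfl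
  have h := attracts_of_trace_four (a := selbergNum₁ X) (m := 3 ^ (k + 1)) (L := 2 * 3 ^ (k + 1))
    (by omega) (by omega)
    (fun k => by rw [aeval_selbergNum₁, aeval_selbergNum₁, selbergNum₁_add_period hθ.pow_eq_one]) hθ
    (fun ζ hζ => exists_periodMatrix_selbergNum₁ hm hζ (by rw [hodd.neg_one_pow]; norm_num)
      (by rw [hodd.neg_one_pow]; norm_num))
    (aeval_ne_zero_of_eval_one_ne_zero hθ _ (by rwa [aeval_transferMat]))
  simp only [aeval_selbergNum₁] at h
  exact h

end RamanujanSelbergOne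

section RamanujanSelbergTwo

/-- The numerators of the second Ramanujan–Selberg continued fraction. -/
def selbergNum₂ {R : Type*} [CommRing R] (q : R) (n : ℕ) : R :=
  if Odd n then q ^ n + q ^ (2 * n) else q ^ (2 * n)

theorem selbergNum₂_odd {R : Type*} [CommRing R] (q : R) (k : ℕ) :
    selbergNum₂ q (2 * k + 1) = q ^ (2 * k + 1) + q ^ (2 * (2 * k + 1)) := by
  simp [selbergNum₂]

theorem selbergNum₂_even {R : Type*} [CommRing R] (q : R) (k : ℕ) :
    selbergNum₂ q (2 * k) = q ^ (2 * (2 * k)) := by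
  simp [selbergNum₂]

theorem aeval_selbergNum₂ {S : Type*} [CommRing S] (ζ : S) (n : ℕ) :
    aeval ζ (selbergNum₂ (X : ℤ[X]) n) = selbergNum₂ ζ n := by
  unfold selbergNum₂
  split_ifs <;> simp

theorem trace_det_selbergNum₂ {r : ℕ} (hr : 3 ≤ r) (hodd : Odd r) {ζ : ℂ}
    (hζ : IsPrimitiveRoot (ζ ^ 2) r) :
    (transferMat (selbergNum₂ ζ) (2 * r)).trace = 3 + ζ ^ r ∧
      (transferMat (selbergNum₂ ζ) (2 * r)).det = 1 + ζ ^ r := by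
  have hζ0 : ζ ≠ 0 := fun h => hζ.ne_zero (by omega) (by rw [h]; simp)
  -- Dividing by `ζ ^ (4 * k)` gives `p = (ζ ^ 2)⁻¹`, `α = ζ⁻¹` and `η = ζ`.
  rw [transferMat_two_mul (c := fun k => ((ζ ^ 2) ^ 2) ^ k) (f := fun k =>
    !![(ζ ^ 2)⁻¹ + ζ⁻¹ * (ζ ^ 2)⁻¹ ^ k + ((ζ ^ 2)⁻¹ ^ k) ^ 2, 1 + 0 * (ζ ^ 2)⁻¹ ^ k;
      ((ζ ^ 2)⁻¹ ^ k) ^ 2, 1 + 0 * (ζ ^ 2)⁻¹ ^ k]) ?_ (prod_range_pow_succ hζ)]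
  · have h := trace_det_prodUpTo_pair (α := ζ⁻¹) (β := 0) (γ := 0) (η := ζ) hr hζ.inv fun z => by
      field_simp
      ring
    rwa [hodd.neg_pow, sub_neg_eq_add, sub_neg_eq_add] at h
  · intro k
    rw [selbergNum₂_odd, selbergNum₂_even]
    ext i j
    fin_cases i <;> fin_cases j <;>
      simp [numMat, Matrix.mul_apply, Fin.sum_univ_two] <;> field_simp <;> ring

theorem selbergNum₂_add_period {r : ℕ} {ζ : ℂ} (hζ : ζ ^ (2 * r) = 1) (k : ℕ) :
    selbergNum₂ ζ (k + 2 * r) = selbergNum₂ ζ k := by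
  have h1 := pow_add_eq_of_pow_eq_one hζ k 1
  have h2 := pow_add_eq_of_pow_eq_one hζ (2 * k) 2
  rw [one_mul] at h1
  have h3 : Odd (k + 2 * r) ↔ Odd k := by simp [Nat.odd_add]
  unfold selbergNum₂
  simp only [h3, h1, mul_add 2 k, h2]

theorem star_selbergNum₂ {r : ℕ} {ζ : ℂ} (hζ : ζ ^ (2 * r) = 1) {k : ℕ}
    (hk : k < 2 * r) : star (selbergNum₂ ζ k) = selbergNum₂ ζ (2 * r - k) := by
  have h1 : star (ζ ^ k) = ζ ^ (2 * r - k) :=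
    star_pow_eq (by omega) hζ (by rw [Nat.add_sub_cancel' hk.le, hζ])
  have h2 : star (ζ ^ (2 * k)) = ζ ^ (2 * (2 * r - k)) :=
    star_pow_eq (by omega) hζ (by
      rw [← mul_add, Nat.add_sub_cancel' hk.le, mul_comm, pow_mul, hζ, one_pow])
  have h3 : Odd (2 * r - k) ↔ Odd k := by
    rw [Nat.odd_iff, Nat.odd_iff]
    omega
  unfold selbergNum₂
  simp only [h3]
  split_ifs
  · rw [star_add, h1, h2]
  · exact h2

theorem exists_periodMatrix_selbergNum₂ {r : ℕ} (hr : 3 ≤ r) (hodd : Odd r) {ζ : ℂ}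
    (hζ : IsPrimitiveRoot (ζ ^ 2) r) {t d : ℝ} (ht : (t : ℂ) = 3 + ζ ^ r)
    (hd : (d : ℂ) = 1 + ζ ^ r) : ∃ A R b, PeriodMatrix (selbergNum₂ X) (2 * r) 1 t d ζ A R b := by
  have h := trace_det_selbergNum₂ hr hodd hζ
  have h1 : ζ ^ (2 * r) = 1 := by rw [pow_mul, hζ.pow_eq_one]
  refine exists_periodMatrix (by omega) ?_ ?_ ?_ ?_ <;> simp only [aeval_selbergNum₂]
  · rw [selbergNum₂_even, mul_comm, pow_mul, h1]
    norm_num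
  · intro k _ hk
    exact star_selbergNum₂ h1 hk
  · rw [ht]; exact h.1
  · rw [hd]; exact h.2

/-- The order `2 * 3 ^ n` is not a prime power, so reduction at `1` cannot decide whether `b`
vanishes; hence the two-point set. -/
theorem dense_selbergNum₂_six :
    Dense {θ : ℝ | Attracts (contMat (selbergNum₂ (circlePoint θ))) {0, 1}} := by
  refine dense_of_isPrimitiveRoot (b := 3) (c := 2) (by norm_num) (by norm_num) 1 fun n hn θ hθ => ?_
  have hr : 3 ≤ 3 ^ n := Nat.le_self_pow (by omega) 3
  have hodd : Odd (3 ^ n) := Odd.pow (by decide)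
  have hsq : ∀ {ζ : ℂ}, IsPrimitiveRoot ζ (2 * 3 ^ n) → IsPrimitiveRoot (ζ ^ 2) (3 ^ n) :=
    fun hζ => hζ.pow (by omega) rfl
  have hneg : ∀ {ζ : ℂ}, IsPrimitiveRoot ζ (2 * 3 ^ n) → ζ ^ 3 ^ n = -1 := fun hζ =>
    (hζ.pow (by omega) (mul_comm _ _)).eq_neg_one_of_two_right
  have h := attracts_zero_one_of_trace_two (a := selbergNum₂ X) (m := 2 * 3 ^ n) (L := 2 * 3 ^ n)
    (by omega) (by omega)
    (fun k => by rw [aeval_selbergNum₂, aeval_selbergNum₂, selbergNum₂_add_period hθ.pow_eq_one]) hθ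
    (fun ζ hζ => exists_periodMatrix_selbergNum₂ hr hodd (hsq hζ) (by rw [hneg hζ]; norm_num)
      (by rw [hneg hζ]; norm_num))
  simp only [aeval_selbergNum₂] at h
  exact h

theorem dense_selbergNum₂_three :
    Dense {θ : ℝ | Attracts (contMat (selbergNum₂ (circlePoint θ))) {1 / 2}} := by
  refine dense_of_isPrimitiveRoot (b := 3) (c := 1) (by norm_num) (by norm_num) 1 fun n hn θ hθ => ?_
  obtain ⟨k, rfl⟩ : ∃ k, n = k + 1 := ⟨n - 1, by omega⟩
  rw [one_mul] at hθ
  have hr : 3 ≤ 3 ^ (k + 1) := Nat.le_self_pow (by omega) 3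
  have hodd : Odd (3 ^ (k + 1)) := Odd.pow (by decide)
  have hmod : transferMat (fun n => aeval (1 : ZMod 3) (selbergNum₂ (X : ℤ[X]) n))
      (2 * 3 ^ (k + 1)) = (numMat (2 : ZMod 3) * numMat 1) ^ 3 ^ (k + 1) := by
    rw [transferMat_two_mul_mod (x := 2) (y := 1)]
    · intro k
      rw [aeval_selbergNum₂, selbergNum₂_odd, one_pow, one_pow]
      rfl
    · intro k
      rw [aeval_selbergNum₂, selbergNum₂_even, one_pow]
  have hsq : ∀ {ζ : ℂ}, IsPrimitiveRoot ζ (3 ^ (k + 1)) → IsPrimitiveRoot (ζ ^ 2) (3 ^ (k + 1)) :=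
    fun hζ => hζ.pow_of_coprime 2 (Nat.Coprime.pow_right _ (by norm_num))
  have h := attracts_half_of_trace_four (a := selbergNum₂ X) (m := 3 ^ (k + 1))
    (L := 2 * 3 ^ (k + 1)) (by omega) (by omega)
    (fun k => by
      rw [aeval_selbergNum₂, aeval_selbergNum₂, selbergNum₂_add_period]
      rw [mul_comm, pow_mul, hθ.pow_eq_one, one_pow]) hθ
    (fun ζ hζ => exists_periodMatrix_selbergNum₂ hr hodd (hsq hζ)
      (by rw [hζ.pow_eq_one]; norm_num) (by rw [hζ.pow_eq_one]; norm_num))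
    (aeval_ne_zero_of_eval_one_ne_zero hθ _ (by
      rw [map_mul, map_sub, aeval_transferMat, aeval_transferMat, hmod, map_ofNat]
      rcases pow_prime_pow_alternating (x := numMat (2 : ZMod 3) * numMat 1)
        (y := !![1, 2; 2, 0]) (p := 3) (by decide) (by decide) (k + 1) with h | h <;>
        rw [h] <;> decide))
  simp only [aeval_selbergNum₂] at h
  exact h

end RamanujanSelbergTwo

/-! ### Conclusion. -/

theorem disjoint_one_Iic : Disjoint ({1} : Set ℝ) (Set.Iic (9 / 25)) := by
  rw [Set.disjoint_singleton_left, Set.mem_Iic]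
  norm_num

end QContFrac

end

open QContFrac in
/-- Each of the four continued fractions fails to converge in the general sense at uncountably many
points of the unit circle. -/
theorem corollary2 :
    ¬ (QContFrac.generalDivergenceSet QContFrac.rogersRamanujan).Countable ∧
    ¬ (QContFrac.generalDivergenceSet QContFrac.ramanujanSelberg₁).Countable ∧
    ¬ (QContFrac.generalDivergenceSet QContFrac.ramanujanSelberg₂).Countable ∧
    ¬ (QContFrac.generalDivergenceSet QContFrac.ramanujanSelberg₃).Countable := by
  refine ⟨?_, ?_, ?_, ?_⟩
  · exact not_countable_generalDivergenceSet (a := fun q n => q ^ n) (fun n => by fun_prop)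
      isClosed_singleton isClosed_Iic disjoint_one_Iic dense_rogersRamanujan_five
      dense_rogersRamanujan_two
  · refine not_countable_generalDivergenceSet (a := fun q n => selbergNum₁ q n) (fun n => ?_)
      isClosed_singleton isClosed_Iic disjoint_one_Iic dense_selbergNum₁_two
      dense_selbergNum₁_three
    unfold selbergNum₁
    split_ifs <;> fun_prop
  · refine not_countable_generalDivergenceSet (a := fun q n => selbergNum₂ q n) (fun n => ?_)
      (Set.toFinite {0, 1}).isClosed isClosed_singleton ?_ dense_selbergNum₂_six
      dense_selbergNum₂_three
    · unfold selbergNum₂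
      split_ifs <;> fun_prop
    · rw [Set.disjoint_singleton_right]
      norm_num
  · exact not_countable_generalDivergenceSet (a := fun q n => q ^ n + q ^ (2 * n))
      (fun n => by fun_prop) isClosed_singleton isClosed_Iic disjoint_one_Iic
      dense_ramanujanSelberg₃_three dense_ramanujanSelberg₃_five
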